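/- **Theorem (The First Discrete Adiabatic Theorem).** Let $T\ge 1$ be an integer, let $H$ be a complex Hilbert space, and let $W_T(s)$, $s\in\{0,1/T,\dots,1\}$, be unitary operators on $H$ (the walk operators). For a function $f$ of the discrete time $s$ let $Df(s)=f(s+1/T)-f(s)$ and $D^{(k)}=D\circ D^{(k-1)}$, $D^{(1)}=D$. Assume the following. * (Differences.) For $k=1,2$ the numbers $c_k(s)$ satisfy $\|D^{(k)}W_T(s)\|\le c_k(s)/T^k$ for all discrete times $0\le s\le 1-k/T$. * (Multistep gaps.) The spectrum of $W_T(s)$ is a union $\sigma_P(s)\cup\sigma_Q(s)$, and for $k=0,1,2$ and every discrete time $0\le s\le 1-k/T$ there are two disjoint closed arcs $\sigma^{(k)}_P(s)\supseteq\bigcup_{l=0}^k\sigma_P(s+l/T)$ and $\sigma^{(k)}_Q(s)\supseteq\bigcup_{l=0}^k\sigma_Q(s+l/T)$ of the unit circle, and $\Delta_k(s)$ is the minimum angular distance between these two arcs. * $T\ge \max_{s\in\{0,1/T,\dots,1-1/T\}} 2c_1(s)/\Delta_1(s)$. Let $U_T(s)=\prod_{l=0}^{sT-1}W_T(l/T)=W_T(s-1/T)\cdots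 W_T(1/T)W_T(0)$. Let $P_T(s)$ be the spectral projection of $W_T(s)$ onto $\sigma_P(s)$, $Q_T(s)=I-P_T(s)$, $S_T(s)=P_T(s+1/T)P_T(s)+Q_T(s+1/T)Q_T(s)$, $V_T(s)=\bigl(S_T(s)S_T(s)^\dagger\bigr)^{-1/2}S_T(s)$, and let the ideal adiabatic evolution be given by $U^A_T(0)=I$, $U^A_T(s+1/T)=V_T(s)W_T(s)U^A_T(s)$. Put $$\mathcal D_1(z)=\frac1{\sqrt{1-z^2}},\qquad \mathcal D_2(z)=\sqrt{\frac{1+z}{1-z}}-1,\qquad \mathcal D_3(z)=\frac{z}{(1-z^2)^{3/2}},$$ $$\mathcal G_{T,1}(s)=\frac{c_1(s)^2+c_1(s)c_1(s+1/T)}{\pi(1-\cos(\Delta_2(s)/2))}+\frac{2c_2(s)}{\Delta_2(s)},$$ $$\mathcal G_{T,2}(s)=\mathcal G_{T,1}(s)\,\mathcal D_3\!\left(\max\left(\frac{2c_1(s+1/T)}{T\Delta_1(s+1/T)},\frac{2c_1(s)}{T\Delta_1(s)}\right)\right),$$ $$\mathcal G_{T,3}(s)=\mathcal G_{T,2}(s)\left(1+\frac{2c_1(s)}{T\Delta_1(s)}\right)+\mathcal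 D_1\!\left(\frac{2c_1(s)}{T\Delta_1(s)}\right)\left(\mathcal G_{T,1}(s)+\frac{8c_1(s)^2}{\Delta_1(s)^2}\right),$$ $$\mathcal G_{T,4}(s)=\frac{\mathcal G_{T,3}(s)}{T}+c_1(s).$$ Then for every $s\in\{1/T,2/T,\dots,1\}$ such that $2c_1(m/T)/\Delta_1(m/T)\neq T$ for all $0\le m<sT$ (that is, such that no denominator below vanishes; otherwise the right-hand side is infinite), writing $n_\pm=n\pm1$, $$\begin{aligned} \|U_T(s)-U_T^A(s)\|\le{}&\frac{4}{\Delta_0(1/T)}\mathcal D_2\!\left(\frac{2c_1(0)}{T\Delta_1(0)}\right)+\frac{4}{\Delta_0(s)}\mathcal D_2\!\left(\frac{2c_1(s-1/T)}{T\Delta_1(s-1/T)}\right)+2\mathcal D_2\!\left(\frac{2c_1(s-1/T)}{T\Delta_1(s-1/T)}\right)\\ &+\sum_{n=1}^{sT-1}4\left(\frac1{\Delta_0(n_+/T)}+\frac2{\Delta_0(n/T)}\right)\mathcal D_2\!\left(\frac{2c_1(n/T)}{T\Delta_1(n/T)}\right)\mathcal D_2\!\left(\frac{2c_1(n_- /T)}{T\Delta_1(n_-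 /T)}\right)\\ &+\sum_{n=1}^{sT-1}\frac{4\,\mathcal G_{T,3}(n_- /T)}{T^2\Delta_1(n/T)}+\sum_{n=1}^{sT-1}\frac{4c_1(n/T)}{\pi T(1-\cos(\Delta_1(n/T)/2))}\mathcal D_2\!\left(\frac{2c_1(n_- /T)}{T\Delta_1(n_- /T)}\right)\\ &+\sum_{n=1}^{sT-1}\frac{4\,\mathcal G_{T,4}(n_- /T)}{T\Delta_0(n/T)}\mathcal D_2\!\left(\frac{2c_1(n_- /T)}{T\Delta_1(n_- /T)}\right)+\sum_{n=0}^{sT-1}\frac{24c_1(n/T)^2}{T^2\Delta_1(n/T)^2}\\ &+\sum_{n=0}^{sT-1}\frac{4c_1(n/T)^2}{T^2\Delta_1(n/T)^2}\left(1-\frac{2c_1(n/T)}{T\Delta_1(n/T)}\right)^{-1}. \end{aligned}$$ -/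

import Mathlib

noncomputable section

namespace DiscreteAdiabatic

/-! Throughout, a fixed number `T` of steps is given and a discrete time `s = n / T` is represented
by the integer `n`; so `f (n + 1)` stands for the value of `f` at `s + 1 / T`, and the difference
operator `D f (s) = f (s + 1 / T) - f s` is `fwdDiff 1 f n`. -/

/-! ### Arcs and multistep gaps -/

/-- A (nonempty, closed) arc of the unit circle. -/
def IsArc (A : Set ℂ) : Prop :=
  ∃ a b : ℝ, a ≤ b ∧ A = (fun θ : ℝ => Complex.exp (θ * Complex.I)) '' Set.Icc a b

/-- The minimum angular distance between two sets of points of the unit circle. -/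
def angularDist (A B : Set ℂ) : ℝ :=
  sInf (Set.image2 InnerProductGeometry.angle A B)

/-- `δ` is a gap at time `n` for `k + 1` successive steps: it is the minimum angular distance between
two non-intersecting arcs of the unit circle, one containing `σP n, …, σP (n + k)`, the other one
containing `σQ n, …, σQ (n + k)`. -/
def IsMultistepGap (σP σQ : ℕ → Set ℂ) (k n : ℕ) (δ : ℝ) : Prop :=
  ∃ A B : Set ℂ, IsArc A ∧ IsArc B ∧ Disjoint A B ∧
    (⋃ l ∈ Set.Iic k, σP (n + l)) ⊆ A ∧ (⋃ l ∈ Set.Iic k, σQ (n + l)) ⊆ B ∧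
    δ = angularDist A B

/-! ### Actual and ideal evolution -/

section Operators

variable {H : Type*} [NormedAddCommGroup H] [InnerProductSpace ℂ H] [CompleteSpace H]

/-- The spectral projection of the unitary `W` onto the part `σ` of its spectrum, by functional
calculus; `σ` is meant to be open and closed in the spectrum of `W`. -/
def specProj (W : H →L[ℂ] H) (σ : Set ℂ) : H →L[ℂ] H :=
  cfc (σ.indicator (1 : ℂ → ℂ)) W

/-- `U (n + 1) = W n * U n`, `U 0 = 1`, that is `U n = W (n - 1) * ⋯ * W 1 * W 0`. -/
def evolution (W : ℕ → H →L[ℂ] H) : ℕ → H →L[ℂ] H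
  | 0 => 1
  | n + 1 => W n * evolution W n

/-- `S = P' P + Q' Q` for the projections `P`, `P'` and their complements `Q = 1 - P`,
`Q' = 1 - P'`. -/
def opS (P' P : H →L[ℂ] H) : H →L[ℂ] H :=
  P' * P + (1 - P') * (1 - P)

/-- `v = √(S S†)`. -/
def opv (P' P : H →L[ℂ] H) : H →L[ℂ] H :=
  CFC.sqrt (opS P' P * star (opS P' P))

/-- `V = v⁻¹ S`, the unitary of the left polar decomposition of `S` (when `v` is invertible). -/
def opV (P' P : H →L[ℂ] H) : H →L[ℂ] H :=
  Ring.inverse (opv P' P) * opS P' P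

/-- The adiabatic walk operator `W^A(s) = V(s + 1/T, s) W(s)`, where `P(s)` is the spectral
projection of `W(s)` onto `σP(s)`. -/
def adiabaticWalk (W : ℕ → H →L[ℂ] H) (σP : ℕ → Set ℂ) (n : ℕ) : H →L[ℂ] H :=
  opV (specProj (W (n + 1)) (σP (n + 1))) (specProj (W n) (σP n)) * W n

/-- The ideal adiabatic evolution: `U^A(0) = 1`, `U^A(s + 1/T) = W^A(s) U^A(s)`. -/
def adiabaticEvolution (W : ℕ → H →L[ℂ] H) (σP : ℕ → Set ℂ) : ℕ → H →L[ℂ] H :=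
  evolution (adiabaticWalk W σP)

end Operators

/-! ### The scalar functions of the bound -/

def D₁ (z : ℝ) : ℝ := 1 / √(1 - z ^ 2)

def D₂ (z : ℝ) : ℝ := √((1 + z) / (1 - z)) - 1

def D₃ (z : ℝ) : ℝ := z / (1 - z ^ 2) ^ (3 / 2 : ℝ)

section Scalars

variable (T : ℕ) (c Δ : ℕ → ℕ → ℝ)

/-- `c k n` and `Δ k n` stand for `c_k(n/T)` and `Δ_k(n/T)`. -/
def G₁ (n : ℕ) : ℝ :=
  (c 1 n ^ 2 + c 1 n * c 1 (n + 1)) / (Real.pi * (1 - Real.cos (Δ 2 n / 2))) + 2 * c 2 n / Δ 2 n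

def G₂ (n : ℕ) : ℝ :=
  G₁ c Δ n * D₃ (max (2 * c 1 (n + 1) / (T * Δ 1 (n + 1))) (2 * c 1 n / (T * Δ 1 n)))

def G₃ (n : ℕ) : ℝ :=
  G₂ T c Δ n * (1 + 2 * c 1 n / (T * Δ 1 n)) +
    D₁ (2 * c 1 n / (T * Δ 1 n)) * (G₁ c Δ n + 8 * c 1 n ^ 2 / Δ 1 n ^ 2)

def G₄ (n : ℕ) : ℝ := G₃ T c Δ n / T + c 1 n

end Scalars

end DiscreteAdiabatic

end

/-! Write the comparison `A† U` of the two evolutions as a telescoping sum of the increments caused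
by the factors `V† = v + Y`. The part `v` is the identity up to second order. The part `Y` is only
of first order, but it exchanges the ranges of `P` and `1 - P`, and because of the gap it is a
commutator `W† [X, W]` with `X` of the same order. Conjugated by the evolutions such a commutator
is the difference of two successive values of `X`, so summation by parts replaces the sum of the
`Y` by boundary terms and by the increments of `X`, which are of second order as well.

All estimates for projections and for `X` come from one bound: since two disjoint arcs at angular
distance `δ` can be separated by two concentric circles, the Sylvester equation `X R - L X = Z` with
spectra on these arcs is solvable with `‖X‖ ≤ ‖Z‖ / (2 sin (δ / 2))`. -/

noncomputable section

namespace DiscreteAdiabatic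

/-! ### Arcs of the unit circle -/

lemma periodic_exp_ofReal_mul_I :
    Function.Periodic (fun θ : ℝ => Complex.exp (θ * Complex.I)) (2 * Real.pi) := fun θ => by
  simpa using Complex.exp_mul_I_periodic θ

/-- The closed arc of the unit circle swept by the angles in `[a, b]`. -/
def arc (a b : ℝ) : Set ℂ := (fun θ : ℝ => Complex.exp (θ * Complex.I)) '' Set.Icc a b

lemma arc_add_period {p : ℝ}
    (hp : Function.Periodic (fun θ : ℝ => Complex.exp (θ * Complex.I)) p) (a b : ℝ) :
    arc (a + p) (b + p) = arc a b := by
  rw [arc, ← Set.image_add_const_Icc, Set.image_image]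
  exact Set.image_congr fun θ _ => hp θ

lemma angle_exp_le_abs_sub (x y : ℝ) :
    InnerProductGeometry.angle (Complex.exp (x * Complex.I)) (Complex.exp (y * Complex.I))
      ≤ |x - y| := by
  rcases lt_or_ge |x - y| Real.pi with h | h
  · have hmem : x - y ∈ Set.Ioc (-Real.pi) (-Real.pi + 2 * Real.pi) :=
      ⟨(abs_lt.mp h).1, by linarith [(abs_lt.mp h).2]⟩
    rw [Complex.angle_exp_exp, (toIocMod_eq_self Real.two_pi_pos).mpr hmem]
  · exact (InnerProductGeometry.angle_le_pi _ _).trans h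

lemma angularDist_le {A B : Set ℂ} {x y : ℂ} (hx : x ∈ A) (hy : y ∈ B) :
    angularDist A B ≤ InnerProductGeometry.angle x y :=
  csInf_le ⟨0, by rintro _ ⟨x, -, y, -, rfl⟩; exact InnerProductGeometry.angle_nonneg _ _⟩
    ⟨x, hx, y, hy, rfl⟩

lemma angularDist_arc_le {a b p q θ φ : ℝ} (hθ : θ ∈ Set.Icc a b) (hφ : φ ∈ Set.Icc p q) :
    angularDist (arc a b) (arc p q) ≤ |θ - φ| :=
  (angularDist_le (Set.mem_image_of_mem _ hθ) (Set.mem_image_of_mem _ hφ)).trans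
    (angle_exp_le_abs_sub θ φ)

lemma angularDist_comm (A B : Set ℂ) : angularDist A B = angularDist B A := by
  rw [angularDist, Set.image2_swap]
  simp only [InnerProductGeometry.angle_comm, angularDist]

namespace IsArc

variable {A B : Set ℂ}

lemma isCompact (hA : IsArc A) : IsCompact A := by
  obtain ⟨a, b, -, rfl⟩ := hA
  exact isCompact_Icc.image (by fun_prop)

lemma nonempty (hA : IsArc A) : A.Nonempty := by
  obtain ⟨a, b, hab, rfl⟩ := hA
  exact (Set.nonempty_Icc.mpr hab).image _

lemma norm_eq_one (hA : IsArc A) {z : ℂ} (hz : z ∈ A) : ‖z‖ = 1 := by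
  obtain ⟨a, b, -, rfl⟩ := hA
  obtain ⟨θ, -, rfl⟩ := hz
  exact Complex.norm_exp_ofReal_mul_I θ

lemma exists_angle_eq_angularDist (hA : IsArc A) (hB : IsArc B) :
    ∃ x ∈ A, ∃ y ∈ B, InnerProductGeometry.angle x y = angularDist A B := by
  refine IsCompact.sInf_mem ?_ (hA.nonempty.image2 hB.nonempty)
  rw [← Set.image_prod]
  refine (hA.isCompact.prod hB.isCompact).image_of_continuousOn fun x hx => ?_
  refine (InnerProductGeometry.continuousAt_angle ?_ ?_).continuousWithinAt
  · exact norm_ne_zero_iff.mp (by simp [hA.norm_eq_one hx.1])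
  · exact norm_ne_zero_iff.mp (by simp [hB.norm_eq_one hx.2])

lemma angularDist_pos (hA : IsArc A) (hB : IsArc B) (hAB : Disjoint A B) :
    0 < angularDist A B := by
  obtain ⟨x, hx, y, hy, hxy⟩ := hA.exists_angle_eq_angularDist hB
  refine hxy ▸ (InnerProductGeometry.angle_nonneg x y).lt_of_ne' fun h0 => ?_
  obtain ⟨-, r, hr, rfl⟩ := InnerProductGeometry.angle_eq_zero_iff.mp h0
  have hr1 : r = 1 := by
    simpa [norm_smul, hA.norm_eq_one hx, abs_of_pos hr] using hB.norm_eq_one hy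
  rw [hr1, one_smul] at hy
  exact Set.disjoint_left.mp hAB hx hy

lemma angularDist_le_pi (hA : IsArc A) (hB : IsArc B) : angularDist A B ≤ Real.pi := by
  obtain ⟨x, -, y, -, hxy⟩ := hA.exists_angle_eq_angularDist hB
  exact hxy ▸ InnerProductGeometry.angle_le_pi x y

lemma exists_arc_eq_of_disjoint (hA : IsArc A) (hB : IsArc B) (hAB : Disjoint A B) :
    ∃ a b p q : ℝ, A = arc a b ∧ B = arc p q ∧ a ≤ b ∧ b < p ∧ p ≤ q ∧ q < a + 2 * Real.pi := by
  obtain ⟨a, b, hab, hAab⟩ := hA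
  obtain ⟨p₀, q₀, hpq, hBpq⟩ := hB
  obtain ⟨k, ⟨hap, hpa⟩, -⟩ := existsUnique_add_zsmul_mem_Ico Real.two_pi_pos p₀ a
  set p := p₀ + k • (2 * Real.pi) with hp
  set q := q₀ + k • (2 * Real.pi) with hq
  have hAarc : A = arc a b := hAab
  have hBarc : B = arc p q :=
    hBpq.trans (arc_add_period (periodic_exp_ofReal_mul_I.zsmul k) p₀ q₀).symm
  have hpq' : p ≤ q := add_le_add_left hpq _
  rw [hAarc, hBarc, Set.disjoint_left] at hAB
  refine ⟨a, b, p, q, hAarc, hBarc, hab, ?_, hpq', ?_⟩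
  · by_contra! hpb
    exact hAB ⟨p, ⟨hap, hpb⟩, rfl⟩ ⟨p, ⟨le_rfl, hpq'⟩, rfl⟩
  · by_contra! haq
    exact hAB ⟨a, ⟨le_rfl, hab⟩, rfl⟩
      ⟨a + 2 * Real.pi, ⟨hpa.le, haq⟩, periodic_exp_ofReal_mul_I a⟩

end IsArc

/-! ### Separation of arcs by disks -/

/-- `σ` lies in a closed disk and `τ` outside of the concentric open disk whose radius is larger
by `δ`; this is the form in which a spectral gap enters the Sylvester equation. -/
def DiskSeparated (σ τ : Set ℂ) (δ : ℝ) : Prop :=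
  ∃ (w : ℂ) (r : ℝ), 0 ≤ r ∧ (∀ z ∈ σ, ‖z - w‖ ≤ r) ∧ ∀ z ∈ τ, r + δ ≤ ‖z - w‖

lemma DiskSeparated.mono {σ τ σ' τ' : Set ℂ} {δ : ℝ} (h : DiskSeparated σ τ δ) (hσ : σ' ⊆ σ)
    (hτ : τ' ⊆ τ) : DiskSeparated σ' τ' δ := by
  obtain ⟨w, r, hr, hin, hout⟩ := h
  exact ⟨w, r, hr, fun z hz => hin z (hσ hz), fun z hz => hout z (hτ hz)⟩

lemma norm_sq_exp_sub (m κ θ : ℝ) :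
    ‖Complex.exp (θ * Complex.I) - κ * Complex.exp (m * Complex.I)‖ ^ 2
      = 1 + κ ^ 2 - 2 * κ * Real.cos (θ - m) := by
  have hfactor : Complex.exp (θ * Complex.I) - κ * Complex.exp (m * Complex.I)
      = Complex.exp (m * Complex.I) * (Complex.exp ((θ - m : ℝ) * Complex.I) - κ) := by
    rw [mul_sub, ← Complex.exp_add]
    push_cast
    ring_nf
  rw [hfactor, norm_mul, Complex.norm_exp_ofReal_mul_I, one_mul, ← Complex.normSq_eq_norm_sq,
    Complex.normSq_apply]
  simp only [Complex.sub_re, Complex.sub_im, Complex.exp_ofReal_mul_I_re,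
    Complex.exp_ofReal_mul_I_im, Complex.ofReal_re, Complex.ofReal_im, sub_zero]
  linear_combination Real.sin_sq_add_cos_sq (θ - m)

lemma one_add_sq_sub_two_mul_cos_sub {κ β x : ℝ} (h : κ * Real.cos β = Real.cos x) :
    1 + κ ^ 2 - 2 * κ * Real.cos (β - x) = (κ * Real.sin β - Real.sin x) ^ 2 := by
  rw [Real.cos_sub]
  linear_combination (-κ ^ 2) * Real.sin_sq_add_cos_sq β - Real.sin_sq_add_cos_sq x
    + (κ * Real.cos β - Real.cos x) * h

lemma cos_le_cos_of_le_of_le_two_pi_sub {s t : ℝ} (hs : 0 ≤ s) (hst : s ≤ t)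
    (ht : t ≤ 2 * Real.pi - s) : Real.cos t ≤ Real.cos s := by
  rcases le_total t Real.pi with h | h
  · exact Real.cos_le_cos_of_nonneg_of_le_pi hs h hst
  · rw [← Real.cos_two_pi_sub t]
    exact Real.cos_le_cos_of_nonneg_of_le_pi hs (by linarith) (by linarith)

/-- The disks are centred on the axis of symmetry of the first arc, at distance `cos x / cos β`
from the origin; their boundary circles meet the unit circle at the angles `± (β - x)` and
`± (β + x)` from this axis. -/
lemma diskSeparated_arc {a b p q x : ℝ} (hab : a ≤ b) (hlen : b - a ≤ q - p)
    (hx : 0 < x) (hbp : b + 2 * x < p) (hqa : q + 2 * x < a + 2 * Real.pi) :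
    DiskSeparated (arc a b) (arc p q) (2 * Real.sin x) := by
  set β : ℝ := (b - a) / 2 + x with hβ
  set m : ℝ := (a + b) / 2 with hm
  have hcosβ : 0 < Real.cos β := Real.cos_pos_of_mem_Ioo ⟨by linarith, by linarith⟩
  have hcosx : 0 < Real.cos x := Real.cos_pos_of_mem_Ioo ⟨by linarith, by linarith⟩
  set κ : ℝ := Real.cos x / Real.cos β with hκ
  have hκ0 : 0 < κ := div_pos hcosx hcosβ
  have hκβ : κ * Real.cos β = Real.cos x := div_mul_cancel₀ _ hcosβ.ne'
  have hinner := one_add_sq_sub_two_mul_cos_sub hκβ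
  have houter := one_add_sq_sub_two_mul_cos_sub (x := -x) (hκβ.trans (Real.cos_neg x).symm)
  rw [Real.sin_neg, sub_neg_eq_add, sub_neg_eq_add] at houter
  have hradius : 0 ≤ κ * Real.sin β - Real.sin x := by
    have hsin : 0 ≤ Real.sin (β - x) :=
      Real.sin_nonneg_of_nonneg_of_le_pi (by linarith) (by linarith)
    rw [hκ, div_mul_eq_mul_div, sub_nonneg, le_div_iff₀ hcosβ]
    linarith [Real.sin_sub β x]
  refine ⟨κ * Complex.exp (m * Complex.I), κ * Real.sin β - Real.sin x, hradius, ?_, ?_⟩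
  · rintro _ ⟨θ, ⟨haθ, hθb⟩, rfl⟩
    have hcos : Real.cos (β - x) ≤ Real.cos (θ - m) := by
      rw [← Real.cos_abs (θ - m)]
      exact Real.cos_le_cos_of_nonneg_of_le_pi (abs_nonneg _) (by linarith)
        (abs_le.mpr ⟨by linarith, by linarith⟩)
    refine le_of_sq_le_sq ?_ hradius
    rw [norm_sq_exp_sub, ← hinner]
    linarith [mul_le_mul_of_nonneg_left hcos hκ0.le]
  · rintro _ ⟨θ, ⟨hpθ, hθq⟩, rfl⟩
    have hcos : Real.cos (θ - m) ≤ Real.cos (β + x) :=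
      cos_le_cos_of_le_of_le_two_pi_sub (by linarith) (by linarith) (by linarith)
    refine le_of_sq_le_sq ?_ (norm_nonneg _)
    rw [norm_sq_exp_sub, show κ * Real.sin β - Real.sin x + 2 * Real.sin x
      = κ * Real.sin β + Real.sin x by ring, ← houter]
    linarith [mul_le_mul_of_nonneg_left hcos hκ0.le]

lemma IsArc.diskSeparated_or {A B : Set ℂ} (hA : IsArc A) (hB : IsArc B) (hAB : Disjoint A B)
    {x : ℝ} (hx : 0 < x) (hxd : 2 * x < angularDist A B) :
    DiskSeparated A B (2 * Real.sin x) ∨ DiskSeparated B A (2 * Real.sin x) := by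
  obtain ⟨a, b, p, q, rfl, rfl, hab, hbp, hpq, hqa⟩ := hA.exists_arc_eq_of_disjoint hB hAB
  have hshift := arc_add_period periodic_exp_ofReal_mul_I a b
  have hgap₁ : b + 2 * x < p := by
    have := angularDist_arc_le (Set.right_mem_Icc.mpr hab) (Set.left_mem_Icc.mpr hpq)
    rw [abs_sub_comm, abs_of_pos (sub_pos.mpr hbp)] at this
    linarith
  have hgap₂ : q + 2 * x < a + 2 * Real.pi := by
    have := angularDist_arc_le (Set.left_mem_Icc.mpr (add_le_add_left hab (2 * Real.pi)))
      (Set.right_mem_Icc.mpr hpq)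
    rw [hshift, abs_of_pos (sub_pos.mpr hqa)] at this
    linarith
  rcases le_total (b - a) (q - p) with hlen | hlen
  · exact .inl (diskSeparated_arc hab hlen hx hgap₁ hgap₂)
  · refine .inr ?_
    rw [← hshift]
    exact diskSeparated_arc hpq (by linarith) hx hgap₂ (by linarith)

/-! ### Sylvester equations -/

section Sylvester

variable {𝓐 : Type*} [NormedRing 𝓐]

/-- Well-posedness, with constant `κ`, of the Sylvester equation `X R - L X = Z` on the corner
`{X | E X = X = X G}`, where `E` and `G` are meant to be idempotents commuting with `L` and `R`. -/
structure SylvesterWellPosed (L E R G : 𝓐) (κ : ℝ) : Prop where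
  norm_le : ∀ X, E * X = X → X * G = X → ‖X‖ ≤ κ * ‖X * R - L * X‖
  exists_solution : ∀ Z, E * Z = Z → Z * G = Z →
    ∃ X, E * X = X ∧ X * G = X ∧ X * R - L * X = Z

lemma SylvesterWellPosed.of_op {L E R G : 𝓐} {κ : ℝ}
    (h : SylvesterWellPosed (MulOpposite.op R) (MulOpposite.op G) (MulOpposite.op L)
    (MulOpposite.op E) κ) : SylvesterWellPosed L E R G κ where
  norm_le X hEX hXG := by
    have hop := h.norm_le (MulOpposite.op X) (congrArg MulOpposite.op hXG)
      (congrArg MulOpposite.op hEX)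
    rwa [← MulOpposite.op_mul, ← MulOpposite.op_mul, ← MulOpposite.op_sub, MulOpposite.norm_op,
      MulOpposite.norm_op, norm_sub_rev] at hop
  exists_solution Z hEZ hZG := by
    obtain ⟨X, hGX, hXE, hX⟩ := h.exists_solution (MulOpposite.op (-Z))
      (congrArg MulOpposite.op ((neg_mul Z G).trans (congrArg _ hZG)))
      (congrArg MulOpposite.op ((mul_neg E Z).trans (congrArg _ hEZ)))
    refine ⟨X.unop, congrArg MulOpposite.unop hXE, congrArg MulOpposite.unop hGX, ?_⟩
    have hunop : L * X.unop - X.unop * R = -Z := congrArg MulOpposite.unop hX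
    rw [← neg_sub, hunop, neg_neg]

variable [NormedAlgebra ℂ 𝓐]

lemma exists_eq_mul_mul_add [CompleteSpace 𝓐] {a b : 𝓐} (hab : ‖a‖ * ‖b‖ < 1) (c : 𝓐) :
    ∃ X, X = a * X * b + c := by
  have h : ‖ContinuousLinearMap.mulLeftRight ℂ 𝓐 a b‖ < 1 :=
    (ContinuousLinearMap.opNorm_mulLeftRight_apply_apply_le ℂ 𝓐 a b).trans_lt hab
  obtain ⟨u, hu⟩ := isUnit_one_sub_of_norm_lt_one h
  refine ⟨(↑u⁻¹ : 𝓐 →L[ℂ] 𝓐) c, ?_⟩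
  have hinv := congrArg (fun f : 𝓐 →L[ℂ] 𝓐 => f c) u.mul_inv
  simp only [hu, mul_apply_eq_comp, sub_apply, one_apply_eq_self,
    ContinuousLinearMap.mulLeftRight_apply] at hinv
  rw [add_comm]
  exact sub_eq_iff_eq_add.mp hinv

namespace SylvesterWellPosed

variable {L E R G M : 𝓐} {κ r ρ : ℝ}

lemma of_sub_algebraMap (w : ℂ)
    (h : SylvesterWellPosed (L - algebraMap ℂ 𝓐 w) E (R - algebraMap ℂ 𝓐 w) G κ) :
    SylvesterWellPosed L E R G κ := by
  have hshift : ∀ X, X * (R - algebraMap ℂ 𝓐 w) - (L - algebraMap ℂ 𝓐 w) * X = X * R - L * X :=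
    fun X => by
      rw [mul_sub, sub_mul, Algebra.commutes w X, sub_sub_sub_cancel_right]
  constructor
  · simpa only [hshift] using h.norm_le
  · simpa only [hshift] using h.exists_solution

/-- With `M` the inverse of `R` on the range of `G`, the equation is the fixed point equation
`X = (L E) X M + Z M`. -/
lemma of_norm_left_le [CompleteSpace 𝓐] (hr : 0 ≤ r) (hrρ : r < ρ) (hLE : Commute L E)
    (hE : E * E = E) (hL : ‖L * E‖ ≤ r) (hRM : R * M = G) (hMR : M * R = G) (hMG : M * G = M)
    (hM : ‖M‖ ≤ ρ⁻¹) : SylvesterWellPosed L E R G (ρ - r)⁻¹ := by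
  have hρ : 0 < ρ := hr.trans_lt hrρ
  constructor
  · intro X hEX hXG
    have hfix : X = (L * E * X + (X * R - L * X)) * M := by
      rw [mul_assoc L E, hEX, add_sub_cancel, mul_assoc, hRM, hXG]
    have hbound : ‖X‖ ≤ (r * ‖X‖ + ‖X * R - L * X‖) * ρ⁻¹ := by
      conv_lhs => rw [hfix]
      exact norm_mul_le_of_le
        (norm_add_le_of_le (norm_mul_le_of_le hL le_rfl) le_rfl) hM
    rw [← div_eq_mul_inv, le_div_iff₀ hρ] at hbound
    rw [inv_mul_eq_div, le_div_iff₀ (sub_pos.mpr hrρ)]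
    linarith
  · intro Z hEZ hZG
    have hcontr : ‖L * E‖ * ‖M‖ < 1 := calc
      ‖L * E‖ * ‖M‖ ≤ r * ρ⁻¹ := by gcongr
      _ < 1 := by rwa [← div_eq_mul_inv, div_lt_one hρ]
    obtain ⟨X, hX⟩ := exists_eq_mul_mul_add hcontr (Z * M)
    have hEX : E * X = X := calc
      E * X = E * (L * E) * X * M + E * Z * M := by
        conv_lhs => rw [hX]
        noncomm_ring
      _ = X := by rw [← mul_assoc E L, ← hLE.eq, mul_assoc L E E, hE, hEZ, ← hX]
    have hXG : X * G = X := calc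
      X * G = L * E * X * (M * G) + Z * (M * G) := by
        conv_lhs => rw [hX]
        noncomm_ring
      _ = X := by rw [hMG, ← hX]
    refine ⟨X, hEX, hXG, sub_eq_iff_eq_add'.mpr ?_⟩
    calc X * R = L * (E * X) * (M * R) + Z * (M * R) := by
          conv_lhs => rw [hX]
          noncomm_ring
      _ = L * X + Z := by rw [hMR, hEX, hZG, mul_assoc, hXG]

lemma of_norm_right_le [CompleteSpace 𝓐] (hr : 0 ≤ r) (hrρ : r < ρ) (hRG : Commute R G)
    (hG : G * G = G) (hR : ‖R * G‖ ≤ r) (hLM : L * M = E) (hML : M * L = E) (hEM : E * M = M)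
    (hM : ‖M‖ ≤ ρ⁻¹) : SylvesterWellPosed L E R G (ρ - r)⁻¹ := by
  refine of_op (of_norm_left_le (M := MulOpposite.op M) hr hrρ hRG.op
    (congrArg MulOpposite.op hG) ?_ (congrArg MulOpposite.op hML) (congrArg MulOpposite.op hLM)
    (congrArg MulOpposite.op hEM) hM)
  rwa [← MulOpposite.op_mul, MulOpposite.norm_op, ← hRG.eq]

end SylvesterWellPosed

end Sylvester

/-! ### Spectral projections -/

section Spectral

variable {H : Type*} [NormedAddCommGroup H] [InnerProductSpace ℂ H] [CompleteSpace H]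

/-- The spectrum of the normal operator `W` is the union of the disjoint closed sets `σ` and `τ`,
so that `specProj W σ` and `specProj W τ` are complementary spectral projections. -/
structure SpectralSplit (W : H →L[ℂ] H) (σ τ : Set ℂ) : Prop where
  normal : IsStarNormal W
  spectrum_eq : spectrum ℂ W = σ ∪ τ
  isClosed_left : IsClosed σ
  isClosed_right : IsClosed τ
  disjoint : Disjoint σ τ

namespace SpectralSplit

variable {W : H →L[ℂ] H} {σ τ : Set ℂ}

lemma symm (h : SpectralSplit W σ τ) : SpectralSplit W τ σ :=
  ⟨h.normal, by rw [h.spectrum_eq, Set.union_comm], h.isClosed_right, h.isClosed_left,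
    h.disjoint.symm⟩

lemma continuousOn_indicator (h : SpectralSplit W σ τ) {f : ℂ → ℂ} (hf : ContinuousOn f σ) :
    ContinuousOn (σ.indicator f) (spectrum ℂ W) := by
  rw [h.spectrum_eq]
  refine ContinuousOn.union_of_isClosed ?_ ?_ h.isClosed_left h.isClosed_right
  · exact hf.congr fun z hz => Set.indicator_of_mem hz f
  · exact (continuousOn_const (c := (0 : ℂ))).congr fun z hz =>
      Set.indicator_of_notMem (Set.disjoint_right.mp h.disjoint hz) f

lemma continuousOn_indicator_one (h : SpectralSplit W σ τ) :
    ContinuousOn (σ.indicator (1 : ℂ → ℂ)) (spectrum ℂ W) :=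
  h.continuousOn_indicator continuousOn_const

lemma cfc_indicator_mul_cfc_indicator (h : SpectralSplit W σ τ) {f g k : ℂ → ℂ}
    (hf : ContinuousOn f σ) (hg : ContinuousOn g σ) (hfg : ∀ z ∈ σ, f z * g z = k z) :
    cfc (σ.indicator f) W * cfc (σ.indicator g) W = cfc (σ.indicator k) W := by
  rw [← cfc_mul _ _ _ (h.continuousOn_indicator hf) (h.continuousOn_indicator hg)]
  refine cfc_congr fun z _ => ?_
  by_cases hz : z ∈ σ <;> simp [hz, hfg]

lemma isStarProjection (h : SpectralSplit W σ τ) : IsStarProjection (specProj W σ) := by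
  constructor
  · exact h.cfc_indicator_mul_cfc_indicator continuousOn_const continuousOn_const (by simp)
  · rw [IsSelfAdjoint, specProj, ← cfc_star]
    refine cfc_congr fun z _ => ?_
    by_cases hz : z ∈ σ <;> simp [hz]

lemma one_sub (h : SpectralSplit W σ τ) : 1 - specProj W σ = specProj W τ := by
  have := h.normal
  rw [specProj, ← cfc_const_one ℂ W, ← cfc_sub _ _ _ continuousOn_const
    h.continuousOn_indicator_one, specProj]
  refine cfc_congr fun z hz => ?_
  rw [h.spectrum_eq] at hz
  rcases hz with hz | hz
  · simp [hz, Set.disjoint_left.mp h.disjoint hz]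
  · simp [hz, Set.disjoint_right.mp h.disjoint hz]

lemma commute (h : SpectralSplit W σ τ) : Commute W (specProj W σ) := by
  have := h.normal
  exact ((Commute.refl W).cfc (star_comm_self' W) _).symm

lemma sub_algebraMap_mul (h : SpectralSplit W σ τ) (w : ℂ) :
    (W - algebraMap ℂ _ w) * specProj W σ = cfc (σ.indicator fun z => z - w) W := by
  have := h.normal
  have hsub : W - algebraMap ℂ _ w = cfc (fun z => z - w) W := by
    rw [cfc_sub _ _ _ (by fun_prop) (by fun_prop), cfc_id' ℂ W, cfc_const w W]
  rw [hsub, specProj, ← cfc_mul _ _ _ (by fun_prop) h.continuousOn_indicator_one]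
  refine cfc_congr fun z _ => ?_
  by_cases hz : z ∈ σ <;> simp [hz]

lemma norm_sub_algebraMap_mul_le (h : SpectralSplit W σ τ) {w : ℂ} {r : ℝ} (hr : 0 ≤ r)
    (hσ : ∀ z ∈ σ, ‖z - w‖ ≤ r) : ‖(W - algebraMap ℂ _ w) * specProj W σ‖ ≤ r := by
  rw [h.sub_algebraMap_mul]
  refine norm_cfc_le hr fun z _ => ?_
  by_cases hz : z ∈ σ
  · simpa [hz] using hσ z hz
  · simpa [hz] using hr

lemma exists_corner_inverse (h : SpectralSplit W σ τ) {w : ℂ} {ρ : ℝ} (hρ : 0 < ρ)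
    (hσ : ∀ z ∈ σ, ρ ≤ ‖z - w‖) : ∃ M : H →L[ℂ] H,
      (W - algebraMap ℂ _ w) * M = specProj W σ ∧ M * (W - algebraMap ℂ _ w) = specProj W σ ∧
      M * specProj W σ = M ∧ specProj W σ * M = M ∧ ‖M‖ ≤ ρ⁻¹ := by
  have hne : ∀ z ∈ σ, z - w ≠ 0 := fun z hz => norm_pos_iff.mp (hρ.trans_le (hσ z hz))
  have hinv : ContinuousOn (fun z => (z - w)⁻¹) σ := ContinuousOn.inv₀ (by fun_prop) hne
  have hsub : ContinuousOn (fun z => z - w) σ := by fun_prop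
  set M := cfc (σ.indicator fun z => (z - w)⁻¹) W
  have hPM : specProj W σ * M = M :=
    h.cfc_indicator_mul_cfc_indicator continuousOn_const hinv (by simp)
  have hMP : M * specProj W σ = M :=
    h.cfc_indicator_mul_cfc_indicator hinv continuousOn_const (by simp)
  refine ⟨M, ?_, ?_, hMP, hPM, ?_⟩
  · rw [← hPM, ← mul_assoc, h.sub_algebraMap_mul]
    exact h.cfc_indicator_mul_cfc_indicator hsub hinv fun z hz => mul_inv_cancel₀ (hne z hz)
  · have hcomm : Commute (W - algebraMap ℂ _ w) (specProj W σ) :=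
      h.commute.sub_left (Algebra.commute_algebraMap_left w _)
    rw [← hMP, mul_assoc, ← hcomm.eq, h.sub_algebraMap_mul]
    exact h.cfc_indicator_mul_cfc_indicator hinv hsub fun z hz => inv_mul_cancel₀ (hne z hz)
  · refine norm_cfc_le (by positivity) fun z _ => ?_
    by_cases hz : z ∈ σ
    · simpa [hz] using inv_anti₀ hρ (hσ z hz)
    · simpa [hz] using hρ.le

variable {L R : H →L[ℂ] H} {σ' τ' : Set ℂ} {δ : ℝ}

lemma sylvesterWellPosed_of_diskSeparated (hL : SpectralSplit L σ τ') (hR : SpectralSplit R τ σ')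
    (hδ : 0 < δ) (h : DiskSeparated σ τ δ ∨ DiskSeparated τ σ δ) :
    SylvesterWellPosed L (specProj L σ) R (specProj R τ) δ⁻¹ := by
  have hLw (w : ℂ) := hL.commute.sub_left (Algebra.commute_algebraMap_left w _)
  have hRw (w : ℂ) := hR.commute.sub_left (Algebra.commute_algebraMap_left w _)
  rcases h with ⟨w, r, hr, hin, hout⟩ | ⟨w, r, hr, hin, hout⟩ <;>
    rw [← add_sub_cancel_left r δ] <;> refine .of_sub_algebraMap w ?_
  · obtain ⟨M, hRM, hMR, hMG, -, hM⟩ := hR.exists_corner_inverse (by linarith) hout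
    exact .of_norm_left_le hr (by linarith) (hLw w) hL.isStarProjection.isIdempotentElem
      (hL.norm_sub_algebraMap_mul_le hr hin) hRM hMR hMG hM
  · obtain ⟨M, hLM, hML, -, hEM, hM⟩ := hL.exists_corner_inverse (by linarith) hout
    exact .of_norm_right_le hr (by linarith) (hRw w) hR.isStarProjection.isIdempotentElem
      (hR.norm_sub_algebraMap_mul_le hr hin) hLM hML hEM hM

/-- Half the angular distance is reached only in the limit: for two arcs of equal length centred
at opposite points, the disks of `diskSeparated_arc` degenerate to half planes there. -/
lemma sylvesterWellPosed_of_isArc {A B : Set ℂ} (hL : SpectralSplit L σ τ')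
    (hR : SpectralSplit R τ σ') (hA : IsArc A) (hB : IsArc B) (hAB : Disjoint A B) (hσ : σ ⊆ A)
    (hτ : τ ⊆ B) :
    SylvesterWellPosed L (specProj L σ) R (specProj R τ)
      (2 * Real.sin (angularDist A B / 2))⁻¹ := by
  set d := angularDist A B
  have hd0 : 0 < d := hA.angularDist_pos hB hAB
  have hdpi : d ≤ Real.pi := hA.angularDist_le_pi hB
  have hsin : ∀ x, 0 < x → x ≤ d / 2 → 0 < 2 * Real.sin x := fun x hx hxd =>
    mul_pos two_pos (Real.sin_pos_of_pos_of_lt_pi hx (by linarith))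
  have happrox : ∀ x ∈ Set.Ioo 0 (d / 2),
      SylvesterWellPosed L (specProj L σ) R (specProj R τ) (2 * Real.sin x)⁻¹ := fun x hx =>
    sylvesterWellPosed_of_diskSeparated hL hR (hsin x hx.1 hx.2.le)
      ((hA.diskSeparated_or hB hAB hx.1 (by linarith [hx.2])).imp
        (fun h => h.mono hσ hτ) fun h => h.mono hτ hσ)
  refine ⟨fun X hEX hXG => ?_, (happrox (d / 4) ⟨by linarith, by linarith⟩).exists_solution⟩
  rw [le_inv_mul_iff₀ (hsin _ (half_pos hd0) le_rfl)]
  have hcont : ContinuousWithinAt (fun x => 2 * Real.sin x * ‖X‖) (Set.Iio (d / 2)) (d / 2) := by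
    fun_prop
  refine le_of_tendsto hcont ?_
  filter_upwards [Ioo_mem_nhdsLT (half_pos hd0)] with x hx
  rw [← le_inv_mul_iff₀ (hsin x hx.1 hx.2.le)]
  exact (happrox x hx).norm_le X hEX hXG

end SpectralSplit

end Spectral

/-! ### Blocks with respect to projections -/

section Blocks

variable {𝓐 : Type*} [CStarAlgebra 𝓐] {N P R : 𝓐}

lemma norm_mul_add_mul_one_sub_le (hP : IsStarProjection P) {a b : 𝓐} (ha : a * P = a)
    (hb : b * (1 - P) = b) (hab : star a * b = 0) : ‖a + b‖ ≤ max ‖a‖ ‖b‖ := by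
  let _ := CStarAlgebra.spectralOrder 𝓐
  let _ := CStarAlgebra.spectralOrderedRing 𝓐
  set m := max ‖a‖ ‖b‖
  have hm0 : 0 ≤ m := (norm_nonneg a).trans (le_max_left _ _)
  have hle : ∀ {x E : 𝓐}, IsStarProjection E → x * E = x → ‖x‖ ≤ m →
      star x * x ≤ algebraMap ℝ 𝓐 (m ^ 2) * E := fun {x E} hE hxE hx => calc
    star x * x = star E * (star x * x) * E := by
      rw [← mul_assoc, ← star_mul, mul_assoc, hxE]
    _ ≤ star E * algebraMap ℝ 𝓐 (m ^ 2) * E :=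
      star_left_conjugate_le_conjugate (CStarAlgebra.star_mul_le_algebraMap_norm_sq.trans
        (algebraMap_mono 𝓐 (pow_le_pow_left₀ (norm_nonneg x) hx 2))) E
    _ = algebraMap ℝ 𝓐 (m ^ 2) * E := by
      rw [hE.isSelfAdjoint.star_eq, ← Algebra.commutes, mul_assoc, hE.isIdempotentElem]
  have hba : star b * a = 0 := by rw [← star_star_mul, hab, star_zero]
  have hsq : star (a + b) * (a + b) ≤ algebraMap ℝ 𝓐 (m ^ 2) := calc
    star (a + b) * (a + b) = star a * a + star b * b := by
      rw [star_add, add_mul, mul_add, mul_add, hab, hba, add_zero, zero_add]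
    _ ≤ algebraMap ℝ 𝓐 (m ^ 2) * P + algebraMap ℝ 𝓐 (m ^ 2) * (1 - P) :=
      add_le_add (hle hP ha (le_max_left _ _)) (hle hP.one_sub hb (le_max_right _ _))
    _ = algebraMap ℝ 𝓐 (m ^ 2) := by rw [← mul_add, add_sub_cancel, mul_one]
  refine abs_le_of_sq_le_sq' ?_ hm0 |>.2
  rw [sq, ← CStarRing.norm_star_mul_self]
  exact (CStarAlgebra.norm_le_iff_le_algebraMap _ (sq_nonneg m)
    (star_mul_self_nonneg _)).mpr hsq

lemma norm_mul_mul_add_le (hN : IsStarProjection N) (hP : IsStarProjection P) (X Y : 𝓐) :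
    ‖N * X * P + (1 - N) * Y * (1 - P)‖ ≤ max ‖N * X * P‖ ‖(1 - N) * Y * (1 - P)‖ := by
  refine norm_mul_add_mul_one_sub_le hP ?_ ?_ ?_
  · rw [mul_assoc _ P, hP.isIdempotentElem]
  · rw [mul_assoc _ (1 - P), hP.one_sub.isIdempotentElem]
  · calc star (N * X * P) * ((1 - N) * Y * (1 - P))
        = star P * star X * (star N * (1 - N)) * Y * (1 - P) := by
          simp only [star_mul, mul_assoc]
      _ = 0 := by rw [hN.isSelfAdjoint.star_eq, hN.mul_one_sub_self]; simp only [mul_zero, zero_mul]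

lemma norm_le_max_add_max (hN : IsStarProjection N) (hP : IsStarProjection P) (X : 𝓐) :
    ‖X‖ ≤ max ‖N * X * P‖ ‖(1 - N) * X * (1 - P)‖
      + max ‖N * X * (1 - P)‖ ‖(1 - N) * X * P‖ := by
  have hoff := norm_mul_mul_add_le hN hP.one_sub X X
  rw [sub_sub_cancel] at hoff
  calc ‖X‖ = ‖(N * X * P + (1 - N) * X * (1 - P)) + (N * X * (1 - P) + (1 - N) * X * P)‖ := by
        congr 1
        noncomm_ring
    _ ≤ _ := norm_add_le_of_le (norm_mul_mul_add_le hN hP X X) hoff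

lemma norm_mul_mul_le (hN : IsStarProjection N) (hP : IsStarProjection P) (X : 𝓐) :
    ‖N * X * P‖ ≤ ‖X‖ := calc
  ‖N * X * P‖ ≤ 1 * ‖X‖ * 1 :=
    norm_mul_le_of_le (norm_mul_le_of_le (hN.norm_le N) le_rfl) (hP.norm_le P)
  _ = ‖X‖ := by rw [one_mul, mul_one]

lemma norm_mul_sub_mul_le (hP : IsStarProjection P) (X : 𝓐) : ‖P * X - X * P‖ ≤ ‖X‖ := calc
  ‖P * X - X * P‖ = ‖P * X * (1 - P) + (1 - P) * (-X) * (1 - (1 - P))‖ := by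
    congr 1
    noncomm_ring
  _ ≤ max ‖P * X * (1 - P)‖ ‖(1 - P) * (-X) * (1 - (1 - P))‖ :=
    norm_mul_mul_add_le hP hP.one_sub X (-X)
  _ ≤ ‖X‖ := max_le (norm_mul_mul_le hP hP.one_sub X)
    ((norm_mul_mul_le hP.one_sub hP.one_sub.one_sub _).trans_eq (norm_neg X))

lemma norm_sub_le_max (hN : IsStarProjection N) (hP : IsStarProjection P) :
    ‖N - P‖ ≤ max ‖N * (1 - P)‖ ‖(1 - N) * P‖ := by
  have h := norm_mul_mul_add_le hN hP.one_sub 1 (-1)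
  rw [mul_one, mul_neg_one, neg_mul, norm_neg, sub_sub_cancel] at h
  refine le_of_eq_of_le (congrArg _ ?_) h
  noncomm_ring

lemma norm_mul_one_sub_le (hN : IsStarProjection N) (hP : IsStarProjection P) :
    ‖N * (1 - P)‖ ≤ ‖N - P‖ := by
  have h : N * (1 - P) = N * (N - P) * (1 - P) := by
    rw [mul_sub N N P, hN.isIdempotentElem.eq, sub_mul, mul_assoc N P, hP.mul_one_sub_self,
      mul_zero, sub_zero]
  rw [h]
  exact norm_mul_mul_le hN hP.one_sub _

lemma norm_one_sub_sub_one_sub (X Y : 𝓐) : ‖(1 - X) - (1 - Y)‖ = ‖X - Y‖ := by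
  rw [sub_sub_sub_cancel_left, norm_sub_rev]

lemma norm_mul_mul_self_le_of_mul_mul_self_eq_zero (hP : IsStarProjection P)
    (hN : IsStarProjection N) {X : 𝓐} (hX : P * X * P = 0) :
    ‖N * X * N‖ ≤ 2 * ‖N - P‖ * ‖X‖ := by
  have h : N * X * N = (N - P) * X * N + P * X * (N - P) := by
    rw [mul_sub, hX]
    noncomm_ring
  have hleft : ‖(N - P) * X * N‖ ≤ ‖N - P‖ * ‖X‖ * 1 :=
    norm_mul_le_of_le (norm_mul_le _ _) (hN.norm_le N)
  have hright : ‖P * X * (N - P)‖ ≤ 1 * ‖X‖ * ‖N - P‖ :=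
    norm_mul_le_of_le (norm_mul_le_of_le (hP.norm_le P) le_rfl) le_rfl
  rw [h]
  linarith [norm_add_le ((N - P) * X * N) (P * X * (N - P))]

end Blocks

/-! ### Consequences of a gap -/

lemma SylvesterWellPosed.norm_mul_mul_le {𝓐 : Type*} [NormedRing 𝓐] {L E R G : 𝓐} {κ : ℝ}
    (h : SylvesterWellPosed L E R G κ) (hE : IsIdempotentElem E) (hG : IsIdempotentElem G)
    (hLE : Commute L E) (hRG : Commute R G) (X : 𝓐) :
    ‖E * X * G‖ ≤ κ * ‖E * (X * R - L * X) * G‖ := by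
  refine (h.norm_le (E * X * G) ?_ ?_).trans_eq (congrArg (κ * ‖·‖) ?_)
  · rw [← mul_assoc, ← mul_assoc, hE]
  · rw [mul_assoc, hG]
  · rw [mul_assoc _ G R, ← hRG.eq, ← mul_assoc L, ← mul_assoc L, hLE.eq]
    noncomm_ring

section Gap

variable {𝓐 : Type*} [CStarAlgebra 𝓐]

/-- The part of `L` on the range of the projection `E` has a gap, of inverse width `κ`, to the part
of `R` on the range of `1 - G`, and likewise for `1 - E` and `G`. -/
structure GapBound (L E R G : 𝓐) (κ : ℝ) : Prop where
  isStarProjection_left : IsStarProjection E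
  isStarProjection_right : IsStarProjection G
  commute_left : Commute L E
  commute_right : Commute R G
  nonneg : 0 ≤ κ
  wellPosed : SylvesterWellPosed L E R (1 - G) κ
  wellPosed_compl : SylvesterWellPosed L (1 - E) R G κ

namespace GapBound

variable {L E R G : 𝓐} {κ : ℝ}

lemma compl (h : GapBound L E R G κ) : GapBound L (1 - E) R (1 - G) κ where
  isStarProjection_left := h.isStarProjection_left.one_sub
  isStarProjection_right := h.isStarProjection_right.one_sub
  commute_left := (Commute.one_right L).sub_right h.commute_left
  commute_right := (Commute.one_right R).sub_right h.commute_right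
  nonneg := h.nonneg
  wellPosed := by rw [sub_sub_cancel]; exact h.wellPosed_compl
  wellPosed_compl := by rw [sub_sub_cancel]; exact h.wellPosed

lemma norm_mul_mul_one_sub_le (h : GapBound L E R G κ) (X : 𝓐) :
    ‖E * X * (1 - G)‖ ≤ κ * ‖E * (X * R - L * X) * (1 - G)‖ :=
  h.wellPosed.norm_mul_mul_le h.isStarProjection_left.isIdempotentElem
    h.isStarProjection_right.one_sub.isIdempotentElem h.commute_left h.compl.commute_right X

lemma norm_mul_mul_one_sub_le_norm (h : GapBound L E R G κ) (X : 𝓐) :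
    ‖E * X * (1 - G)‖ ≤ κ * ‖X * R - L * X‖ :=
  (h.norm_mul_mul_one_sub_le X).trans (mul_le_mul_of_nonneg_left
    (norm_mul_mul_le h.isStarProjection_left h.isStarProjection_right.one_sub _) h.nonneg)

lemma norm_sub_le (h : GapBound L E R G κ) : ‖E - G‖ ≤ κ * ‖R - L‖ := by
  have hoff := h.norm_mul_mul_one_sub_le_norm 1
  have hoff' := h.compl.norm_mul_mul_one_sub_le_norm 1
  rw [one_mul, mul_one, mul_one] at hoff hoff'
  rw [sub_sub_cancel] at hoff'
  exact (norm_sub_le_max h.isStarProjection_left h.isStarProjection_right).trans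
    (max_le hoff hoff')

end GapBound

end Gap

section SecondDifference

variable {𝓐 : Type*} [CStarAlgebra 𝓐] {WR WP WN R P N : 𝓐} {κ : ℝ}

lemma norm_secondDiff_diag_le (hR : IsStarProjection R) (hP : IsStarProjection P)
    (hN : IsStarProjection N) : ‖N * (N - P - (P - R)) * P‖ ≤ ‖N - R‖ * ‖P - R‖ := by
  have hblock : N * (N - P - (P - R)) * P = -((N * (1 - R)) * ((1 - R) * (1 - (1 - P)))) := by
    rw [sub_sub_cancel, ← mul_assoc, mul_assoc N (1 - R), hR.one_sub.isIdempotentElem]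
    calc N * (N - P - (P - R)) * P = N * N * P - 2 • (N * (P * P)) + N * R * P := by noncomm_ring
      _ = -(N * (1 - R) * P) := by
        rw [hN.isIdempotentElem, hP.isIdempotentElem]
        noncomm_ring
  rw [hblock, norm_neg, ← norm_one_sub_sub_one_sub P]
  exact norm_mul_le_of_le (norm_mul_one_sub_le hN hR)
    ((norm_mul_one_sub_le hR.one_sub hP.one_sub).trans_eq (norm_sub_rev _ _))

/-- The Sylvester equation satisfied by the second difference: the right-hand side only involves
differences because `W P = P W` at each of the three times. -/
lemma secondDiff_sylvester (hP : IsStarProjection P) (hN : IsStarProjection N)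
    (cR : Commute WR R) (cP : Commute WP P) (cN : Commute WN N) :
    N * ((N - P - (P - R)) * WP - WN * (N - P - (P - R))) * (1 - P)
      = -(N * (WN - WP - (WP - WR)) * (1 - P)) - (N * (1 - R)) * (WP - WR) * (1 - P)
        - N * (WN - WR) * (R * (1 - P)) := by
  have hPP : ∀ x, P * (P * x) = P * x := fun x => by rw [← mul_assoc, hP.isIdempotentElem]
  have hNN : ∀ x, N * (N * x) = N * x := fun x => by rw [← mul_assoc, hN.isIdempotentElem]
  have hWR : ∀ x, WR * (R * x) = R * (WR * x) := fun x => by rw [← mul_assoc, cR.eq, mul_assoc]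
  simp only [mul_sub, sub_mul, mul_one, mul_assoc, cR.eq, cP.eq, cN.eq, hWR,
    hP.isIdempotentElem.eq, hNN, hPP]
  abel

namespace GapBound

lemma norm_secondDiff_offDiag_le (h : GapBound WN N WP P κ) (hR : IsStarProjection R)
    (cR : Commute WR R) :
    ‖N * (N - P - (P - R)) * (1 - P)‖ ≤ κ * (‖WN - WP - (WP - WR)‖ + ‖N - R‖ * ‖WP - WR‖
      + ‖WN - WR‖ * ‖P - R‖) := by
  have hN := h.isStarProjection_left
  have hP := h.isStarProjection_right
  refine (h.norm_mul_mul_one_sub_le _).trans (mul_le_mul_of_nonneg_left ?_ h.nonneg)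
  rw [secondDiff_sylvester hP hN cR h.commute_right h.commute_left]
  refine norm_sub_le_of_le (norm_sub_le_of_le ?_ ?_) ?_
  · rw [norm_neg]
    exact norm_mul_mul_le hN hP.one_sub _
  · exact (norm_mul_le_of_le (norm_mul_le_of_le (norm_mul_one_sub_le hN hR) le_rfl)
      (hP.one_sub.norm_le _)).trans_eq (mul_one _)
  · rw [norm_sub_rev P]
    exact (norm_mul_le_of_le (norm_mul_le_of_le (hN.norm_le N) le_rfl)
      (norm_mul_one_sub_le hR hP)).trans_eq (by rw [one_mul])

lemma norm_secondDiff_le (h : GapBound WN N WP P κ) (hR : IsStarProjection R)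
    (cR : Commute WR R) :
    ‖N - P - (P - R)‖ ≤ ‖N - R‖ * ‖P - R‖ + κ * (‖WN - WP - (WP - WR)‖ + ‖N - R‖ * ‖WP - WR‖
      + ‖WN - WR‖ * ‖P - R‖) := by
  have hN := h.isStarProjection_left
  have hP := h.isStarProjection_right
  have hcompl : (1 - N) - (1 - P) - ((1 - P) - (1 - R)) = -(N - P - (P - R)) := by abel
  have hdiag := norm_secondDiff_diag_le hR.one_sub hP.one_sub hN.one_sub
  have hoff := h.compl.norm_secondDiff_offDiag_le hR.one_sub
    ((Commute.one_right WR).sub_right cR)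
  rw [norm_one_sub_sub_one_sub, norm_one_sub_sub_one_sub, hcompl, mul_neg, neg_mul, norm_neg]
    at hdiag hoff
  rw [sub_sub_cancel] at hoff
  exact (norm_le_max_add_max hN hP _).trans (add_le_add
    (max_le (norm_secondDiff_diag_le hR hP hN) hdiag)
    (max_le (h.norm_secondDiff_offDiag_le hR cR) hoff))

end GapBound

end SecondDifference

/-! ### Off-diagonal solutions of the commutator equation -/

section Commutator

variable {𝓐 : Type*} [CStarAlgebra 𝓐] {W W' P P' X X' Y Y' : 𝓐} {κ : ℝ}

/-- `X` exchanges the ranges of `P` and `1 - P` and solves the commutator equation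
`[X, W] = W Y`, which turns `Y` into a difference of conjugates. -/
structure OffDiagSolution (P W Y X : 𝓐) : Prop where
  offDiag : P * X = X * (1 - P)
  commutator_eq : X * W - W * X = W * Y

namespace OffDiagSolution

lemma compl (h : OffDiagSolution P W Y X) : OffDiagSolution (1 - P) W Y X where
  offDiag := by rw [sub_mul, h.offDiag, one_mul, mul_sub X 1 P, mul_one]; noncomm_ring
  commutator_eq := h.commutator_eq

lemma mul_mul_self_eq_zero (h : OffDiagSolution P W Y X) (hP : IsIdempotentElem P) :
    P * X * P = 0 := by
  rw [h.offDiag, mul_assoc, hP.one_sub_mul_self, mul_zero]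

lemma norm_le (h : OffDiagSolution P W Y X) (hgap : GapBound W P W P κ) (hW : ‖W‖ ≤ 1) :
    ‖X‖ ≤ κ * ‖Y‖ := by
  have hP := hgap.isStarProjection_left
  have hcomm : ‖X * W - W * X‖ ≤ ‖Y‖ := by
    rw [h.commutator_eq]
    exact (norm_mul_le_of_le hW le_rfl).trans_eq (one_mul _)
  have hκ := mul_le_mul_of_nonneg_left hcomm hgap.nonneg
  have hcompl := hgap.compl.norm_mul_mul_one_sub_le_norm X
  rw [sub_sub_cancel] at hcompl
  have hsum := norm_le_max_add_max hP hP X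
  rw [h.mul_mul_self_eq_zero hP.isIdempotentElem,
    h.compl.mul_mul_self_eq_zero hP.one_sub.isIdempotentElem, norm_zero, max_self, zero_add] at hsum
  exact hsum.trans (max_le ((hgap.norm_mul_mul_one_sub_le_norm X).trans hκ) (hcompl.trans hκ))

lemma norm_commutator_sub_le (h : OffDiagSolution P W Y X) (h' : OffDiagSolution P' W' Y' X')
    (hW' : ‖W'‖ ≤ 1) :
    ‖(X' - X) * W' - W' * (X' - X)‖ ≤ ‖Y' - Y‖ + ‖W' - W‖ * (‖Y‖ + 2 * ‖X‖) := by
  have hdiff : (X' - X) * W' - W' * (X' - X)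
      = W' * (Y' - Y) + (W' - W) * Y - X * (W' - W) + (W' - W) * X := by
    calc _ = (X' * W' - W' * X') - (X * W - W * X) - X * (W' - W) + (W' - W) * X := by
          noncomm_ring
      _ = _ := by rw [h.commutator_eq, h'.commutator_eq]; noncomm_ring
  rw [hdiff]
  refine (norm_add_le_of_le (norm_sub_le_of_le (norm_add_le_of_le (norm_mul_le_of_le hW' le_rfl)
    (norm_mul_le _ _)) (norm_mul_le _ _)) (norm_mul_le _ _)).trans_eq ?_
  ring

lemma norm_sub_le (h : OffDiagSolution P W Y X) (h' : OffDiagSolution P' W' Y' X')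
    (hP : IsStarProjection P) (hgap : GapBound W' P' W' P' κ) (hW' : ‖W'‖ ≤ 1) :
    ‖X' - X‖ ≤ 2 * ‖P' - P‖ * ‖X‖ + κ * (‖Y' - Y‖ + ‖W' - W‖ * (‖Y‖ + 2 * ‖X‖)) := by
  have hdiag : ∀ {E E' : 𝓐}, IsStarProjection E → IsStarProjection E' →
      OffDiagSolution E W Y X → OffDiagSolution E' W' Y' X' →
      ‖E' * (X' - X) * E'‖ ≤ 2 * ‖E' - E‖ * ‖X‖ := fun hE hE' h h' => by
    rw [mul_sub, sub_mul, h'.mul_mul_self_eq_zero hE'.isIdempotentElem, zero_sub, norm_neg]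
    exact norm_mul_mul_self_le_of_mul_mul_self_eq_zero hE hE'
      (h.mul_mul_self_eq_zero hE.isIdempotentElem)
  have hP' := hgap.isStarProjection_left
  have hdiag' := hdiag hP.one_sub hP'.one_sub h.compl h'.compl
  rw [norm_one_sub_sub_one_sub] at hdiag'
  have hoff := hgap.compl.norm_mul_mul_one_sub_le_norm (X' - X)
  rw [sub_sub_cancel] at hoff
  have hκ := mul_le_mul_of_nonneg_left (h.norm_commutator_sub_le h' hW') hgap.nonneg
  exact (norm_le_max_add_max hP' hP' _).trans (add_le_add (max_le (hdiag hP hP' h h') hdiag')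
    (max_le ((hgap.norm_mul_mul_one_sub_le_norm _).trans hκ) (hoff.trans hκ)))

end OffDiagSolution

lemma GapBound.exists_offDiagSolution (h : GapBound W P W P κ) (hY : P * Y = Y * (1 - P)) :
    ∃ X, OffDiagSolution P W Y X := by
  have hP := h.isStarProjection_left
  have hWY : P * (W * Y) = W * Y * (1 - P) := by
    rw [← mul_assoc, ← h.commute_left.eq, mul_assoc, hY, mul_assoc]
  have hWY' : (1 - P) * (W * Y) = W * Y * P := by
    rw [sub_mul, hWY, one_mul, mul_sub, mul_one, sub_sub_cancel]
  obtain ⟨X₁, hPX₁, hX₁Q, hX₁⟩ := h.wellPosed.exists_solution (P * (W * Y))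
    (by rw [← mul_assoc, hP.isIdempotentElem])
    (by rw [hWY, mul_assoc, hP.one_sub.isIdempotentElem])
  obtain ⟨X₂, hQX₂, hX₂P, hX₂⟩ := h.wellPosed_compl.exists_solution ((1 - P) * (W * Y))
    (by rw [← mul_assoc, hP.one_sub.isIdempotentElem])
    (by rw [hWY', mul_assoc, hP.isIdempotentElem])
  refine ⟨X₁ + X₂, ?_, ?_⟩
  · have hPX₂ : P * X₂ = 0 := by rw [← hQX₂, ← mul_assoc, hP.mul_one_sub_self, zero_mul]
    have hX₂Q : X₂ * (1 - P) = 0 := by rw [mul_sub, hX₂P, mul_one, sub_self]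
    rw [mul_add, add_mul, hPX₁, hX₁Q, hPX₂, hX₂Q]
  · calc (X₁ + X₂) * W - W * (X₁ + X₂) = (X₁ * W - W * X₁) + (X₂ * W - W * X₂) := by noncomm_ring
      _ = W * Y := by rw [hX₁, hX₂, ← add_mul, add_sub_cancel, one_mul]

end Commutator

/-! ### Elements close to one -/

section NearOne

variable {𝓐 : Type*} [CStarAlgebra 𝓐] {a b : 𝓐} {α : ℝ}

lemma isUnit_of_norm_one_sub_le (hα : 0 < α) (ha : ‖1 - a‖ ≤ 1 - α) : IsUnit a := by
  have h := isUnit_one_sub_of_norm_lt_one (ha.trans_lt (sub_lt_self 1 hα))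
  rwa [sub_sub_cancel] at h

lemma ringInverse_sub_one_eq (ha : IsUnit a) :
    Ring.inverse a - 1 = (1 - a) * Ring.inverse a := by
  rw [sub_mul, one_mul, Ring.mul_inverse_cancel a ha]

lemma norm_ringInverse_le (hα : 0 < α) (ha : ‖1 - a‖ ≤ 1 - α) : ‖Ring.inverse a‖ ≤ α⁻¹ := by
  have hone : ‖(1 : 𝓐)‖ ≤ 1 := (IsStarProjection.one 𝓐).norm_le 1
  have hinv : ‖Ring.inverse a‖ ≤ 1 + (1 - α) * ‖Ring.inverse a‖ := by
    conv_lhs => rw [← add_sub_cancel 1 (Ring.inverse a),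
      ringInverse_sub_one_eq (isUnit_of_norm_one_sub_le hα ha)]
    exact norm_add_le_of_le hone (norm_mul_le_of_le ha le_rfl)
  rw [← one_div, le_div_iff₀ hα]
  linarith

lemma norm_ringInverse_sub_one_le (hα : 0 < α) (ha : ‖1 - a‖ ≤ 1 - α) :
    ‖Ring.inverse a - 1‖ ≤ α⁻¹ - 1 := by
  rw [ringInverse_sub_one_eq (isUnit_of_norm_one_sub_le hα ha)]
  refine (norm_mul_le_of_le ha (norm_ringInverse_le hα ha)).trans_eq ?_
  rw [sub_mul, one_mul, mul_inv_cancel₀ hα.ne']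

lemma two_mul_norm_sub_le_norm_mul_self_sub (ha : ‖1 - a‖ ≤ 1 - α) (hb : ‖1 - b‖ ≤ 1 - α) :
    2 * α * ‖a - b‖ ≤ ‖a * a - b * b‖ := by
  have hdouble : (a - b) + (a - b)
      = (1 - b) * (a - b) + (a - b) * (1 - a) + (a * a - b * b) := by noncomm_ring
  have hnorm : 2 * ‖a - b‖ ≤ (1 - α) * ‖a - b‖ + ‖a - b‖ * (1 - α) + ‖a * a - b * b‖ := calc
    2 * ‖a - b‖ = ‖(a - b) + (a - b)‖ := by rw [← two_nsmul, RCLike.norm_nsmul ℂ, nsmul_eq_mul]; rfl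
    _ ≤ _ := by
      rw [hdouble]
      exact norm_add_le_of_le (norm_add_le_of_le (norm_mul_le_of_le hb le_rfl)
        (norm_mul_le_of_le le_rfl ha)) le_rfl
  linarith

lemma norm_ringInverse_sub_ringInverse_le (hα : 0 < α) (ha : ‖1 - a‖ ≤ 1 - α)
    (hb : ‖1 - b‖ ≤ 1 - α) :
    ‖Ring.inverse a - Ring.inverse b‖ ≤ α⁻¹ ^ 3 / 2 * ‖a * a - b * b‖ := by
  have hunit : IsUnit a ↔ IsUnit b :=
    iff_of_true (isUnit_of_norm_one_sub_le hα ha) (isUnit_of_norm_one_sub_le hα hb)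
  have hab : ‖b - a‖ ≤ α⁻¹ / 2 * ‖a * a - b * b‖ := by
    rw [norm_sub_rev, inv_eq_one_div, div_div, one_div_mul_eq_div, le_div_iff₀ (by positivity)]
    linarith [two_mul_norm_sub_le_norm_mul_self_sub ha hb]
  rw [Ring.inverse_sub_inverse hunit]
  refine (norm_mul_le_of_le (norm_mul_le_of_le (norm_ringInverse_le hα ha) hab)
    (norm_ringInverse_le hα hb)).trans_eq ?_
  ring

end NearOne

lemma commute_ringInverse {R : Type*} [Ring R] {a b : R} (h : Commute a b) :
    Commute (Ring.inverse a) b := by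
  by_cases ha : IsUnit a
  · obtain ⟨u, rfl⟩ := ha
    rw [Ring.inverse_unit]
    exact Commute.units_inv_left h
  · rw [Ring.inverse_non_unit _ ha]
    exact Commute.zero_left b

lemma commute_sub_mul_sub_left {R : Type*} [Ring R] {p q : R} (hp : IsIdempotentElem p)
    (hq : IsIdempotentElem q) : Commute ((q - p) * (q - p)) p := by
  have hpp : ∀ x, p * (p * x) = p * x := fun x => by rw [← mul_assoc, hp]
  rw [Commute, SemiconjBy]
  simp only [mul_sub, sub_mul, mul_assoc, hp.eq, hq.eq, hpp]
  abel

/-! ### The scalar functions -/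

section Scalar

variable {z : ℝ}

lemma one_sub_sq_pos (hz0 : 0 ≤ z) (hz1 : z < 1) : 0 < 1 - z ^ 2 :=
  sub_pos.mpr (pow_lt_one₀ hz0 hz1 two_ne_zero)

lemma D₁_eq_inv (z : ℝ) : D₁ z = (√(1 - z ^ 2))⁻¹ := one_div _

lemma one_le_D₁ (hz0 : 0 ≤ z) (hz1 : z < 1) : 1 ≤ D₁ z := by
  rw [D₁_eq_inv]
  exact (one_le_inv₀ (Real.sqrt_pos.mpr (one_sub_sq_pos hz0 hz1))).mpr
    (Real.sqrt_le_one.mpr (sub_le_self 1 (sq_nonneg z)))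

lemma D₂_eq (hz0 : 0 ≤ z) : D₂ z = (1 + z) * D₁ z - 1 := by
  have hz : 0 < 1 + z := by positivity
  have hfactor : 1 - z ^ 2 = (1 + z) * (1 - z) := by ring
  rw [D₂, D₁, hfactor, Real.sqrt_div hz.le, Real.sqrt_mul hz.le, mul_one_div,
    ← div_div, Real.div_sqrt]

lemma le_D₂ (hz0 : 0 ≤ z) (hz1 : z < 1) : z ≤ D₂ z := by
  rw [D₂_eq hz0]
  nlinarith [one_le_D₁ hz0 hz1]

lemma D₃_eq (hz0 : 0 ≤ z) (hz1 : z < 1) : D₃ z = z * D₁ z ^ 3 := by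
  have hpow : (1 - z ^ 2) ^ (3 / 2 : ℝ) = √(1 - z ^ 2) ^ 3 := by
    rw [Real.sqrt_eq_rpow, ← Real.rpow_mul_natCast (one_sub_sq_pos hz0 hz1).le]
    norm_num
  rw [D₃, D₁_eq_inv, hpow, inv_pow, div_eq_mul_inv]

end Scalar

/-! ### The polar decomposition of `opS` -/

section Polar

variable {H : Type*} [NormedAddCommGroup H] [InnerProductSpace ℂ H] [CompleteSpace H]
  {P P' : H →L[ℂ] H} {z : ℝ}

lemma opS_mul_star (hP : IsStarProjection P) (hP' : IsStarProjection P') :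
    opS P' P * star (opS P' P) = 1 - (P' - P) * (P' - P) := by
  have hPP : ∀ x, P * (P * x) = P * x := fun x => by rw [← mul_assoc, hP.isIdempotentElem]
  simp only [opS, star_add, star_mul, star_sub, star_one, hP.isSelfAdjoint.star_eq,
    hP'.isSelfAdjoint.star_eq, mul_sub, sub_mul, mul_add, add_mul, mul_one, one_mul, mul_assoc,
    hP.isIdempotentElem.eq, hP'.isIdempotentElem.eq, hPP]
  abel

omit [CompleteSpace H] in
lemma opS_eq (hP : IsIdempotentElem P) (hP' : IsIdempotentElem P') :
    opS P' P = 1 - (P' - P) * (P' - P) - (P * P' - P' * P) := by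
  simp only [opS, mul_sub, sub_mul, mul_one, one_mul, hP.eq, hP'.eq]
  abel

lemma norm_opS_sub_one (hP : IsStarProjection P) (P' : H →L[ℂ] H) :
    ‖opS P' P - 1‖ = ‖P' - P‖ := by
  have h : opS P' P - 1 = (P' - P) * (2 * P - 1) := by
    simp only [opS, mul_sub, sub_mul, mul_one, one_mul, two_mul, mul_add, hP.isIdempotentElem.eq]
    abel
  rw [h, CStarRing.norm_mul_mem_unitary _ hP.two_mul_sub_one_mem_unitary]

lemma opv_mul_self (hP : IsStarProjection P) (hP' : IsStarProjection P') :
    opv P' P * opv P' P = 1 - (P' - P) * (P' - P) := by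
  rw [opv, CFC.sqrt_mul_sqrt_self _ (mul_star_self_nonneg _), opS_mul_star hP hP']

lemma star_opv (P' P : H →L[ℂ] H) : star (opv P' P) = opv P' P :=
  (IsSelfAdjoint.of_nonneg (CFC.sqrt_nonneg _)).star_eq

lemma commute_opv {B : H →L[ℂ] H} (hP : IsStarProjection P) (hP' : IsStarProjection P')
    (h : Commute ((P' - P) * (P' - P)) B) : Commute (opv P' P) B := by
  have hS : Commute (opS P' P * star (opS P' P)) B := by
    rw [opS_mul_star hP hP']
    exact (Commute.one_left B).sub_left h
  exact hS.cfcₙ_nnreal _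

lemma commute_opv_left (hP : IsStarProjection P) (hP' : IsStarProjection P') :
    Commute (opv P' P) P :=
  commute_opv hP hP' (commute_sub_mul_sub_left hP.isIdempotentElem hP'.isIdempotentElem)

lemma commute_opv_right (hP : IsStarProjection P) (hP' : IsStarProjection P') :
    Commute (opv P' P) P' := by
  refine commute_opv hP hP' ?_
  rw [← neg_sub, neg_mul_neg]
  exact commute_sub_mul_sub_left hP'.isIdempotentElem hP.isIdempotentElem

lemma commute_opv_commutator (hP : IsStarProjection P) (hP' : IsStarProjection P') :
    Commute (opv P' P) (P * P' - P' * P) :=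
  ((commute_opv_left hP hP').mul_right (commute_opv_right hP hP')).sub_right
    ((commute_opv_right hP hP').mul_right (commute_opv_left hP hP'))

lemma abs_le_of_mem_spectrum {D : H →L[ℂ] H} (hz : ‖D‖ ≤ z) {x : ℝ} (hx : x ∈ spectrum ℝ D) :
    |x| ≤ z := by
  rcases subsingleton_or_nontrivial (H →L[ℂ] H) with h | h
  · simp [spectrum.of_subsingleton] at hx
  · exact (spectrum.norm_le_norm_of_mem hx).trans hz

lemma opv_eq_cfc (hP : IsStarProjection P) (hP' : IsStarProjection P') (h1 : ‖P' - P‖ ≤ 1) :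
    opv P' P = cfc (fun x : ℝ => √(1 - x ^ 2)) (P' - P) := by
  have hD : IsSelfAdjoint (P' - P) := hP'.isSelfAdjoint.sub hP.isSelfAdjoint
  have hcont : Continuous fun x : ℝ => √(1 - x ^ 2) := by fun_prop
  refine CFC.sqrt_unique ?_ (cfc_nonneg fun x _ => Real.sqrt_nonneg _)
  rw [opS_mul_star hP hP', ← cfc_mul _ _ _ hcont.continuousOn hcont.continuousOn, ← sq,
    ← cfc_const_one ℝ (P' - P), ← cfc_pow_id (R := ℝ) (P' - P) 2,
    ← cfc_sub _ _ _ (by fun_prop) (by fun_prop)]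
  exact cfc_congr fun x hx => Real.mul_self_sqrt
    (sub_nonneg.mpr ((sq_le_one_iff_abs_le_one x).mpr (abs_le_of_mem_spectrum h1 hx)))

/-- `v⁻¹ [P, P']`, up to a sign the part of the unitary `opV P' P` that is off-diagonal with respect
to `P` (and to `P'`). -/
def opY (P' P : H →L[ℂ] H) : H →L[ℂ] H :=
  Ring.inverse (opv P' P) * (P * P' - P' * P)

lemma mul_opY_right (hP : IsStarProjection P) (hP' : IsStarProjection P') :
    P' * opY P' P = opY P' P * (1 - P') := by
  have hP'P' : ∀ x, P' * (P' * x) = P' * x := fun x => by rw [← mul_assoc, hP'.isIdempotentElem]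
  have hcomm : P' * (P * P' - P' * P) = (P * P' - P' * P) * (1 - P') := by
    simp only [mul_sub, sub_mul, mul_one, mul_assoc, hP'.isIdempotentElem.eq, hP'P']
    abel
  rw [opY, ← mul_assoc, ← (commute_ringInverse (commute_opv_right hP hP')).eq, mul_assoc, mul_assoc,
    hcomm]

lemma star_opY (hP : IsStarProjection P) (hP' : IsStarProjection P') :
    star (opY P' P) = -opY P' P := by
  have h : star (P * P' - P' * P) = -(P * P' - P' * P) := by
    simp only [star_sub, star_mul, hP.isSelfAdjoint.star_eq, hP'.isSelfAdjoint.star_eq, neg_sub]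
  rw [opY, star_mul, h, ← Ring.inverse_star, star_opv, neg_mul,
    (commute_ringInverse (commute_opv_commutator hP hP')).eq]

lemma commute_opv_opY (hP : IsStarProjection P) (hP' : IsStarProjection P') :
    Commute (opv P' P) (opY P' P) :=
  (commute_ringInverse (Commute.refl _)).symm.mul_right (commute_opv_commutator hP hP')

/-- `P` and `P'` are orthogonal projections at distance at most `z < 1`, so that `opS P' P` is
invertible and `opV P' P` is a unitary carrying the range of `P` to that of `P'`. -/
structure CloseProjections (P' P : H →L[ℂ] H) (z : ℝ) : Prop where
  right : IsStarProjection P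
  left : IsStarProjection P'
  norm_sub_le : ‖P' - P‖ ≤ z
  lt_one : z < 1

namespace CloseProjections

lemma nonneg (h : CloseProjections P' P z) : 0 ≤ z := (norm_nonneg _).trans h.norm_sub_le

lemma sqrt_pos (h : CloseProjections P' P z) : 0 < √(1 - z ^ 2) :=
  Real.sqrt_pos.mpr (one_sub_sq_pos h.nonneg h.lt_one)

lemma norm_one_sub_opv_le (h : CloseProjections P' P z) :
    ‖1 - opv P' P‖ ≤ 1 - √(1 - z ^ 2) := by
  have hD : IsSelfAdjoint (P' - P) := h.left.isSelfAdjoint.sub h.right.isSelfAdjoint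
  have hle_one : ∀ x : ℝ, √(1 - x ^ 2) ≤ 1 := fun x =>
    Real.sqrt_le_one.mpr (sub_le_self 1 (sq_nonneg x))
  rw [opv_eq_cfc h.right h.left (h.norm_sub_le.trans h.lt_one.le), ← cfc_const_one ℝ (P' - P),
    ← cfc_sub _ _ _ (by fun_prop) (by fun_prop)]
  refine norm_cfc_le (sub_nonneg.mpr (hle_one z)) fun x hx => ?_
  rw [Real.norm_of_nonneg (sub_nonneg.mpr (hle_one x))]
  have hx : x ^ 2 ≤ z ^ 2 := sq_le_sq' (abs_le.mp (abs_le_of_mem_spectrum h.norm_sub_le hx)).1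
    (abs_le.mp (abs_le_of_mem_spectrum h.norm_sub_le hx)).2
  gcongr

lemma isUnit_opv (h : CloseProjections P' P z) : IsUnit (opv P' P) :=
  isUnit_of_norm_one_sub_le h.sqrt_pos h.norm_one_sub_opv_le

lemma norm_inverse_opv_le (h : CloseProjections P' P z) : ‖Ring.inverse (opv P' P)‖ ≤ D₁ z :=
  (norm_ringInverse_le h.sqrt_pos h.norm_one_sub_opv_le).trans_eq (D₁_eq_inv z).symm

lemma opV_eq (h : CloseProjections P' P z) : opV P' P = opv P' P - opY P' P := by
  rw [opV, opS_eq h.right.isIdempotentElem h.left.isIdempotentElem, ← opv_mul_self h.right h.left,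
    mul_sub, ← mul_assoc, Ring.inverse_mul_cancel _ h.isUnit_opv, one_mul, opY]

lemma star_opV (h : CloseProjections P' P z) : star (opV P' P) = opv P' P + opY P' P := by
  rw [h.opV_eq, star_sub, star_opv, star_opY h.right h.left, sub_neg_eq_add]

lemma opV_mul_star (h : CloseProjections P' P z) : opV P' P * star (opV P' P) = 1 := by
  have hstar : star (opV P' P) = star (opS P' P) * Ring.inverse (opv P' P) := by
    rw [opV, star_mul, ← Ring.inverse_star, star_opv]
  rw [hstar, opV, mul_assoc, ← mul_assoc (opS P' P), opS_mul_star h.right h.left,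
    ← opv_mul_self h.right h.left, mul_assoc, Ring.mul_inverse_cancel _ h.isUnit_opv, mul_one,
    Ring.inverse_mul_cancel _ h.isUnit_opv]

lemma opV_mem_unitary (h : CloseProjections P' P z) : opV P' P ∈ unitary (H →L[ℂ] H) := by
  refine Unitary.mem_iff.mpr ⟨?_, h.opV_mul_star⟩
  have hcomm : Commute (star (opV P' P)) (opV P' P) := by
    have hvY := commute_opv_opY h.right h.left
    rw [h.star_opV, h.opV_eq]
    exact ((Commute.refl _).sub_right hvY).add_left (hvY.symm.sub_right (Commute.refl _))
  rw [hcomm.eq, h.opV_mul_star]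

lemma opY_mul_opY (h : CloseProjections P' P z) :
    opY P' P * opY P' P = -((P' - P) * (P' - P)) := by
  have hVV := h.opV_mul_star
  rw [h.star_opV, h.opV_eq, sub_mul, mul_add, mul_add, (commute_opv_opY h.right h.left).eq,
    opv_mul_self h.right h.left, ← sub_eq_zero] at hVV
  rw [← sub_eq_zero, ← neg_eq_zero, ← hVV]
  abel

lemma norm_opY (h : CloseProjections P' P z) : ‖opY P' P‖ = ‖P' - P‖ := by
  have hD : star (P' - P) = P' - P :=
    (h.left.isSelfAdjoint.sub h.right.isSelfAdjoint).star_eq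
  refine (mul_self_inj (norm_nonneg _) (norm_nonneg _)).mp ?_
  rw [← CStarRing.norm_star_mul_self, ← CStarRing.norm_star_mul_self, star_opY h.right h.left, hD,
    neg_mul, h.opY_mul_opY, neg_neg]

lemma norm_opV_sub_one_le (h : CloseProjections P' P z) : ‖opV P' P - 1‖ ≤ D₂ z := by
  have hsplit : opV P' P - 1 = Ring.inverse (opv P' P) * (opS P' P - 1)
      + (Ring.inverse (opv P' P) - 1) := by
    rw [opV]
    noncomm_ring
  have hinv := norm_ringInverse_sub_one_le h.sqrt_pos h.norm_one_sub_opv_le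
  rw [← D₁_eq_inv] at hinv
  rw [hsplit, D₂_eq h.nonneg]
  refine (norm_add_le_of_le (norm_mul_le_of_le h.norm_inverse_opv_le
    ((norm_opS_sub_one h.right P').trans_le h.norm_sub_le)) hinv).trans_eq ?_
  ring

variable {P₀ P₀' P₁ P₁' : H →L[ℂ] H}

lemma norm_inverse_opv_sub_le (h₀ : CloseProjections P₀' P₀ z) (h₁ : CloseProjections P₁' P₁ z) :
    ‖Ring.inverse (opv P₁' P₁) - Ring.inverse (opv P₀' P₀)‖
      ≤ D₃ z * ‖(P₁' - P₁) - (P₀' - P₀)‖ := by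
  set D₀ := P₀' - P₀
  set D₁' := P₁' - P₁
  have hsq : ‖opv P₁' P₁ * opv P₁' P₁ - opv P₀' P₀ * opv P₀' P₀‖ ≤ 2 * z * ‖D₁' - D₀‖ := by
    have hdiff : 1 - D₁' * D₁' - (1 - D₀ * D₀) = -(D₁' * (D₁' - D₀) + (D₁' - D₀) * D₀) := by
      noncomm_ring
    rw [opv_mul_self h₁.right h₁.left, opv_mul_self h₀.right h₀.left, hdiff, norm_neg]
    refine (norm_add_le_of_le (norm_mul_le_of_le h₁.norm_sub_le le_rfl)
      (norm_mul_le_of_le le_rfl h₀.norm_sub_le)).trans_eq ?_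
    ring
  have hα := h₀.sqrt_pos
  calc _ ≤ (√(1 - z ^ 2))⁻¹ ^ 3 / 2 * (2 * z * ‖D₁' - D₀‖) :=
        (norm_ringInverse_sub_ringInverse_le hα h₁.norm_one_sub_opv_le
          h₀.norm_one_sub_opv_le).trans (mul_le_mul_of_nonneg_left hsq (by positivity))
    _ = D₃ z * ‖D₁' - D₀‖ := by
        rw [D₃_eq h₀.nonneg h₀.lt_one, D₁_eq_inv]
        ring

lemma norm_opY_sub_opY_le {N R : H →L[ℂ] H} {z₀ : ℝ} (h₀ : CloseProjections P R z₀)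
    (h₁ : CloseProjections N P z) (hz : z₀ ≤ z) :
    ‖opY N P - opY P R‖ ≤ (D₃ z + D₁ z₀) * ‖(N - P) - (P - R)‖ := by
  have hsplit : opY N P - opY P R
      = (Ring.inverse (opv N P) - Ring.inverse (opv P R)) * (P * (N - P) - (N - P) * P)
        + Ring.inverse (opv P R) * (P * ((N - P) - (P - R)) - ((N - P) - (P - R)) * P) := by
    simp only [opY]
    noncomm_ring
  have h₀' : CloseProjections P R z := ⟨h₀.right, h₀.left, h₀.norm_sub_le.trans hz, h₁.lt_one⟩
  have hcomm : ‖P * (N - P) - (N - P) * P‖ ≤ 1 :=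
    (norm_mul_sub_mul_le h₁.right _).trans (h₁.norm_sub_le.trans h₁.lt_one.le)
  rw [hsplit, add_mul, ← mul_one (D₃ z * _)]
  exact norm_add_le_of_le (norm_mul_le_of_le (h₀'.norm_inverse_opv_sub_le h₁) hcomm)
    (norm_mul_le_of_le h₀.norm_inverse_opv_le (norm_mul_sub_mul_le h₁.right _))

end CloseProjections

end Polar

/-! ### Comparison of two evolutions -/

section Conjugation

variable {𝓐 : Type*} [CStarAlgebra 𝓐] {u : 𝓐}

lemma norm_star_mul_mul_unitary (hu : u ∈ unitary 𝓐) (X : 𝓐) : ‖star u * X * u‖ = ‖X‖ := by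
  rw [CStarRing.norm_mul_mem_unitary _ hu, CStarRing.norm_mem_unitary_mul _ (Unitary.star_mem hu)]

lemma norm_star_mul_mul_sub_le (hu : u ∈ unitary 𝓐) (X X' : 𝓐) :
    ‖star u * X' * u - X‖ ≤ 2 * ‖u - 1‖ * ‖X‖ + ‖X' - X‖ := by
  have hsplit : star u * X' * u - X
      = star u * (X * (u - 1) - (u - 1) * X) + star u * (X' - X) * u := by
    have hX : X = star u * u * X := by rw [(Unitary.mem_iff.mp hu).1, one_mul]
    conv_lhs => rw [hX]
    noncomm_ring
  rw [hsplit]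
  refine norm_add_le_of_le ?_ (norm_star_mul_mul_unitary hu _).le
  rw [CStarRing.norm_mem_unitary_mul _ (Unitary.star_mem hu)]
  refine (norm_sub_le_of_le (norm_mul_le _ _) (norm_mul_le _ _)).trans_eq ?_
  ring

end Conjugation

section Evolution

variable {H : Type*} [NormedAddCommGroup H] [InnerProductSpace ℂ H] [CompleteSpace H]
  {W V v Y X : ℕ → H →L[ℂ] H} {N m : ℕ}

lemma evolution_mem_unitary (hW : ∀ k < m, W k ∈ unitary (H →L[ℂ] H)) :
    evolution W m ∈ unitary (H →L[ℂ] H) := by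
  induction m with
  | zero => exact one_mem _
  | succ m ih => exact mul_mem (hW m m.lt_succ_self) (ih fun k hk => hW k (hk.trans m.lt_succ_self))

/-- The wave operator `A† U` comparing the evolution `U` generated by `W` with the evolution `A`
generated by `V * W`. -/
def waveOperator (W V : ℕ → H →L[ℂ] H) (m : ℕ) : H →L[ℂ] H :=
  star (evolution (V * W) m) * evolution W m

/-- The observable `X m` in the interaction picture of the evolution `A` generated by `W`, read at
time `m + 1`, so that it has absorbed the step `m`: `A (m + 1)† * X m * A (m + 1)`. -/
def interactionPicture (W X : ℕ → H →L[ℂ] H) (m : ℕ) : H →L[ℂ] H :=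
  star (evolution W (m + 1)) * X m * evolution W (m + 1)

section

variable (hW : ∀ k ≤ N, W k ∈ unitary (H →L[ℂ] H)) (hV : ∀ k ≤ N, V k ∈ unitary (H →L[ℂ] H))

include hW hV

lemma evolution_mul_mem_unitary (hm : m ≤ N + 1) :
    evolution (V * W) m ∈ unitary (H →L[ℂ] H) :=
  evolution_mem_unitary fun k hk => mul_mem (hV k (by lia)) (hW k (by lia))

lemma waveOperator_mem_unitary (hm : m ≤ N + 1) :
    waveOperator W V m ∈ unitary (H →L[ℂ] H) :=
  mul_mem (Unitary.star_mem (evolution_mul_mem_unitary hW hV hm))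
    (evolution_mem_unitary fun k hk => hW k (by lia))

lemma norm_interactionPicture (hm : m ≤ N) : ‖interactionPicture (V * W) X m‖ = ‖X m‖ := by
  have hA := evolution_mul_mem_unitary hW hV (Nat.succ_le_succ hm)
  rw [interactionPicture, norm_star_mul_mul_unitary hA]

lemma norm_evolution_sub_evolution_eq :
    ‖evolution W (N + 1) - evolution (V * W) (N + 1)‖ = ‖waveOperator W V (N + 1) - 1‖ := by
  have hA := evolution_mul_mem_unitary hW hV le_rfl
  rw [← CStarRing.norm_mem_unitary_mul (waveOperator W V (N + 1) - 1) hA, mul_sub, mul_one,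
    waveOperator, ← mul_assoc, (Unitary.mem_iff.mp hA).2, one_mul]

lemma waveOperator_succ_sub (hm : m ≤ N) :
    waveOperator W V (m + 1) - waveOperator W V m
      = interactionPicture (V * W) (fun k => star (V k) - 1) m * waveOperator W V m := by
  have hA := Unitary.mem_iff.mp (evolution_mul_mem_unitary hW hV (m := m) (by lia))
  have hA' := Unitary.mem_iff.mp (evolution_mul_mem_unitary hW hV (m := m + 1) (by lia))
  have hback : star (V m) * evolution (V * W) (m + 1) = W m * evolution (V * W) m := by
    rw [evolution, Pi.mul_apply, ← mul_assoc, ← mul_assoc, (Unitary.mem_iff.mp (hV m hm)).1,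
      one_mul]
  have hsucc : star (evolution (V * W) (m + 1)) * star (V m) * evolution (V * W) (m + 1)
      * waveOperator W V m = waveOperator W V (m + 1) := by
    rw [mul_assoc _ (star (V m)), hback, waveOperator, waveOperator, evolution, evolution.eq_2 W,
      mul_assoc, mul_assoc (W m), ← mul_assoc (evolution (V * W) m), hA.2, one_mul]
  rw [interactionPicture, mul_sub, sub_mul, mul_one, hA'.1, sub_mul, one_mul, hsucc]

lemma norm_waveOperator_succ_sub (hm : m ≤ N) :
    ‖waveOperator W V (m + 1) - waveOperator W V m‖ = ‖V m - 1‖ := by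
  have hΩ := waveOperator_mem_unitary hW hV (m := m) (by lia)
  rw [waveOperator_succ_sub hW hV hm, CStarRing.norm_mul_mem_unitary _ hΩ,
    norm_interactionPicture hW hV hm, ← norm_star, star_sub, star_star, star_one]

end

lemma interactionPicture_succ_sub (hW : W (m + 1) ∈ unitary (H →L[ℂ] H))
    (hX : X m * W (m + 1) - W (m + 1) * X m = W (m + 1) * Y m) :
    interactionPicture (V * W) X (m + 1) - interactionPicture (V * W) X m
      = interactionPicture (V * W) Y m + star (W (m + 1) * evolution (V * W) (m + 1))
        * (star (V (m + 1)) * X (m + 1) * V (m + 1) - X m)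
        * (W (m + 1) * evolution (V * W) (m + 1)) := by
  have hY : Y m = star (W (m + 1)) * X m * W (m + 1) - X m := by
    have hWW := (Unitary.mem_iff.mp hW).1
    rw [← one_mul (Y m), ← hWW, mul_assoc, ← hX, mul_sub, ← mul_assoc, ← mul_assoc, hWW, one_mul]
  have hA : evolution (V * W) (m + 1 + 1)
      = V (m + 1) * W (m + 1) * evolution (V * W) (m + 1) := rfl
  simp only [interactionPicture, hA, hY, star_mul]
  noncomm_ring

lemma norm_corrected_succ_sub_le (hW : ∀ k ≤ N, W k ∈ unitary (H →L[ℂ] H))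
    (hV : ∀ k ≤ N, V k ∈ unitary (H →L[ℂ] H)) (hm : m < N) (hvY : star (V m) = v m + Y m)
    (hX : X m * W (m + 1) - W (m + 1) * X m = W (m + 1) * Y m) :
    ‖(1 - interactionPicture (V * W) X (m + 1)) * waveOperator W V (m + 1)
        - (1 - interactionPicture (V * W) X m) * waveOperator W V m‖
      ≤ ‖1 - v m‖ + ‖X (m + 1)‖ * ‖V m - 1‖ + 2 * ‖V (m + 1) - 1‖ * ‖X m‖
        + ‖X (m + 1) - X m‖ := by
  have hΩ := waveOperator_mem_unitary hW hV (m := m) (by lia)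
  have hWA := mul_mem (hW (m + 1) hm) (evolution_mul_mem_unitary hW hV (m := m + 1) (by lia))
  have hstep : waveOperator W V (m + 1) - waveOperator W V m
      = interactionPicture (V * W) (v - 1) m * waveOperator W V m
        + interactionPicture (V * W) Y m * waveOperator W V m := by
    rw [waveOperator_succ_sub hW hV hm.le]
    simp only [interactionPicture, hvY, Pi.sub_apply, Pi.one_apply]
    noncomm_ring
  have hsplit : (1 - interactionPicture (V * W) X (m + 1)) * waveOperator W V (m + 1)
        - (1 - interactionPicture (V * W) X m) * waveOperator W V m
      = interactionPicture (V * W) (v - 1) m * waveOperator W V m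
        - interactionPicture (V * W) X (m + 1) * (waveOperator W V (m + 1) - waveOperator W V m)
        - star (W (m + 1) * evolution (V * W) (m + 1))
          * (star (V (m + 1)) * X (m + 1) * V (m + 1) - X m)
          * (W (m + 1) * evolution (V * W) (m + 1)) * waveOperator W V m := by
    have hparts : ∀ Z Z' Ω Ω' : H →L[ℂ] H, (1 - Z') * Ω' - (1 - Z) * Ω
        = (Ω' - Ω) - Z' * (Ω' - Ω) - (Z' - Z) * Ω := fun Z Z' Ω Ω' => by noncomm_ring
    rw [hparts, interactionPicture_succ_sub (hW (m + 1) hm) hX, add_mul]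
    nth_rw 1 [hstep]
    abel
  have hcorr : ‖interactionPicture (V * W) (v - 1) m * waveOperator W V m‖ = ‖1 - v m‖ := by
    rw [CStarRing.norm_mul_mem_unitary _ hΩ, norm_interactionPicture hW hV hm.le, norm_sub_rev,
      Pi.sub_apply, Pi.one_apply]
  have hmixed : ‖interactionPicture (V * W) X (m + 1)
      * (waveOperator W V (m + 1) - waveOperator W V m)‖ ≤ ‖X (m + 1)‖ * ‖V m - 1‖ :=
    norm_mul_le_of_le (norm_interactionPicture hW hV hm).le
      (norm_waveOperator_succ_sub hW hV hm.le).le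
  rw [hsplit, add_assoc]
  refine norm_sub_le_of_le (norm_sub_le_of_le hcorr.le hmixed) ?_
  rw [CStarRing.norm_mul_mem_unitary _ hΩ, norm_star_mul_mul_unitary hWA]
  exact norm_star_mul_mul_sub_le (hV (m + 1) hm) _ _

/-- Summation by parts: the off-diagonal parts `Y m` of the increments of the wave operator are
themselves increments of `X` in the interaction picture, up to terms of second order. -/
lemma norm_evolution_sub_evolution_le (hW : ∀ k ≤ N, W k ∈ unitary (H →L[ℂ] H))
    (hV : ∀ k ≤ N, V k ∈ unitary (H →L[ℂ] H)) (hvY : ∀ m < N, star (V m) = v m + Y m)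
    (hX : ∀ m < N, X m * W (m + 1) - W (m + 1) * X m = W (m + 1) * Y m) :
    ‖evolution W (N + 1) - evolution (V * W) (N + 1)‖
      ≤ ‖V N - 1‖ + ‖X N‖ + ‖X 0‖ + ∑ m ∈ Finset.range N, (‖1 - v m‖ + ‖X (m + 1)‖ * ‖V m - 1‖
        + 2 * ‖V (m + 1) - 1‖ * ‖X m‖ + ‖X (m + 1) - X m‖) := by
  let Ω := waveOperator W V
  let Z := interactionPicture (V * W) X
  have hΩ0 : Ω 0 = 1 := by simp only [Ω, waveOperator, evolution, star_one, mul_one]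
  have htelescope : Ω (N + 1) - 1 = (Ω (N + 1) - Ω N) + Z N * Ω N - Z 0
      + ∑ m ∈ Finset.range N, ((1 - Z (m + 1)) * Ω (m + 1) - (1 - Z m) * Ω m) := by
    rw [Finset.sum_range_sub fun m => (1 - Z m) * Ω m, hΩ0]
    noncomm_ring
  have hN : ‖Z N * Ω N‖ = ‖X N‖ := by
    have hΩN := waveOperator_mem_unitary hW hV N.le_succ
    rw [CStarRing.norm_mul_mem_unitary _ hΩN, norm_interactionPicture hW hV le_rfl]
  rw [norm_evolution_sub_evolution_eq hW hV, htelescope]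
  refine norm_add_le_of_le (norm_sub_le_of_le (norm_add_le_of_le
    (norm_waveOperator_succ_sub hW hV le_rfl).le hN.le)
    (norm_interactionPicture hW hV N.zero_le).le) ?_
  refine (norm_sum_le _ _).trans (Finset.sum_le_sum fun m hm => ?_)
  have hm := Finset.mem_range.mp hm
  exact norm_corrected_succ_sub_le hW hV hm (hvY m hm) (hX m hm)

end Evolution

/-! ### Multistep gaps -/

section Gap

/-- The norm bound for the inverse of the Sylvester operator `X ↦ L X - X R` when the spectra of
`L` and `R` lie on arcs at angular distance `δ`: the inverse of the length of a chord spanning the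
angle `δ`. -/
def gapConst (δ : ℝ) : ℝ := (2 * Real.sin (δ / 2))⁻¹

variable {δ : ℝ}

lemma sin_half_pos (h0 : 0 < δ) (hpi : δ ≤ Real.pi) : 0 < Real.sin (δ / 2) :=
  Real.sin_pos_of_pos_of_lt_pi (half_pos h0) (by linarith)

lemma one_sub_cos_half_pos (h0 : 0 < δ) (hpi : δ ≤ Real.pi) : 0 < 1 - Real.cos (δ / 2) := by
  nlinarith [sin_half_pos h0 hpi, Real.sin_sq_add_cos_sq (δ / 2), Real.cos_le_one (δ / 2)]

lemma half_le_gapConst (h0 : 0 < δ) (hpi : δ ≤ Real.pi) : 1 / 2 ≤ gapConst δ := by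
  rw [gapConst, one_div]
  exact inv_anti₀ (mul_pos two_pos (sin_half_pos h0 hpi)) (by linarith [Real.sin_le_one (δ / 2)])

lemma gapConst_pos (h0 : 0 < δ) (hpi : δ ≤ Real.pi) : 0 < gapConst δ :=
  one_half_pos.trans_le (half_le_gapConst h0 hpi)

lemma gapConst_le (h0 : 0 < δ) (hpi : δ ≤ Real.pi) : gapConst δ ≤ Real.pi / (2 * δ) := by
  have hjordan : 2 / Real.pi * (δ / 2) ≤ Real.sin (δ / 2) :=
    Real.mul_le_sin (by linarith) (by linarith)
  calc gapConst δ ≤ (2 * (2 / Real.pi * (δ / 2)))⁻¹ := by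
        rw [gapConst]
        gcongr
    _ = Real.pi / (2 * δ) := by field_simp

lemma gapConst_le_two_div (h0 : 0 < δ) (hpi : δ ≤ Real.pi) : gapConst δ ≤ 2 / δ := by
  refine (gapConst_le h0 hpi).trans ?_
  rw [div_le_div_iff₀ (by linarith) h0]
  nlinarith [Real.pi_le_four]

lemma gapConst_sq_le (h0 : 0 < δ) (hpi : δ ≤ Real.pi) :
    gapConst δ ^ 2 ≤ 1 / (4 * (1 - Real.cos (δ / 2))) := by
  have hcos := one_sub_cos_half_pos h0 hpi
  have hcos0 : 0 ≤ Real.cos (δ / 2) := Real.cos_nonneg_of_mem_Icc ⟨by linarith, by linarith⟩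
  rw [gapConst, inv_pow, ← one_div]
  refine one_div_le_one_div_of_le (by positivity) ?_
  nlinarith [Real.sin_sq_add_cos_sq (δ / 2)]

lemma gapConst_add_sq_le (h0 : 0 < δ) (hpi : δ ≤ Real.pi) :
    gapConst δ + 2 * gapConst δ ^ 2 ≤ 4 / (Real.pi * (1 - Real.cos (δ / 2))) := by
  have hcos := one_sub_cos_half_pos h0 hpi
  have hhalf := half_le_gapConst h0 hpi
  calc gapConst δ + 2 * gapConst δ ^ 2 ≤ 4 * gapConst δ ^ 2 := by nlinarith
    _ ≤ 4 * (1 / (4 * (1 - Real.cos (δ / 2)))) := by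
        gcongr
        exact gapConst_sq_le h0 hpi
    _ = 4 / (4 * (1 - Real.cos (δ / 2))) := mul_one_div _ _
    _ ≤ 4 / (Real.pi * (1 - Real.cos (δ / 2))) := by
        gcongr
        exact Real.pi_le_four

lemma pi_sq_le_ten : Real.pi ^ 2 ≤ 10 := by
  nlinarith [Real.pi_lt_d2, Real.pi_pos]

-- The factor `8 / π` is what `gapConst_le` turns into the constant `4` in front of `G₃`.
lemma gapConst_secondDiff_le {c₀ c₁ c₂ : ℝ} (h0 : 0 < δ) (hpi : δ ≤ Real.pi) (hc₀ : 0 ≤ c₀)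
    (hc₁ : 0 ≤ c₁) (hc₂ : 0 ≤ c₂) :
    gapConst δ * c₂ + 3 * gapConst δ ^ 2 * (c₀ ^ 2 + c₀ * c₁) ≤
      8 / Real.pi * ((c₀ ^ 2 + c₀ * c₁) / (Real.pi * (1 - Real.cos (δ / 2))) + 2 * c₂ / δ) := by
  have hcos := one_sub_cos_half_pos h0 hpi
  have hlin : gapConst δ ≤ 8 / Real.pi * (2 / δ) := by
    refine (gapConst_le h0 hpi).trans ?_
    rw [div_mul_div_comm, div_le_div_iff₀ (by positivity) (by positivity)]
    nlinarith [pi_sq_le_ten]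
  have hquad : 3 * gapConst δ ^ 2 ≤ 8 / Real.pi * (1 / (Real.pi * (1 - Real.cos (δ / 2)))) := by
    refine (mul_le_mul_of_nonneg_left (gapConst_sq_le h0 hpi) zero_le_three).trans ?_
    rw [div_mul_div_comm, mul_one_div, div_le_div_iff₀ (by positivity) (by positivity)]
    nlinarith [pi_sq_le_ten]
  calc gapConst δ * c₂ + 3 * gapConst δ ^ 2 * (c₀ ^ 2 + c₀ * c₁)
      ≤ 8 / Real.pi * (2 / δ) * c₂
        + 8 / Real.pi * (1 / (Real.pi * (1 - Real.cos (δ / 2)))) * (c₀ ^ 2 + c₀ * c₁) := by gcongr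
    _ = _ := by ring

end Gap

namespace IsMultistepGap

variable {H : Type*} [NormedAddCommGroup H] [InnerProductSpace ℂ H] [CompleteSpace H]
  {σP σQ : ℕ → Set ℂ} {k n i j : ℕ} {δ : ℝ} {W : ℕ → H →L[ℂ] H}

lemma pos (h : IsMultistepGap σP σQ k n δ) : 0 < δ := by
  obtain ⟨A, B, hA, hB, hAB, -, -, rfl⟩ := h
  exact hA.angularDist_pos hB hAB

lemma le_pi (h : IsMultistepGap σP σQ k n δ) : δ ≤ Real.pi := by
  obtain ⟨A, B, hA, hB, -, -, -, rfl⟩ := h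
  exact hA.angularDist_le_pi hB

lemma symm (h : IsMultistepGap σP σQ k n δ) : IsMultistepGap σQ σP k n δ := by
  obtain ⟨A, B, hA, hB, hAB, hPA, hQB, hδ⟩ := h
  exact ⟨B, A, hB, hA, hAB.symm, hQB, hPA, hδ.trans (angularDist_comm A B)⟩

lemma isClosed_left (h : IsMultistepGap σP σQ 0 n δ) (hσ : IsClosed (σP n ∪ σQ n)) :
    IsClosed (σP n) := by
  obtain ⟨A, B, hA, -, hAB, hPA, hQB, -⟩ := h
  have hP : σP n ⊆ A := fun _ hz => hPA (Set.mem_biUnion (Set.mem_Iic.mpr le_rfl) hz)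
  have hQ : σQ n ⊆ B := fun _ hz => hQB (Set.mem_biUnion (Set.mem_Iic.mpr le_rfl) hz)
  have hinter : (σP n ∪ σQ n) ∩ A = σP n := by
    rw [Set.union_inter_distrib_right, Set.inter_eq_left.mpr hP, (hAB.symm.mono_left hQ).inter_eq,
      Set.union_empty]
  rw [← hinter]
  exact hσ.inter hA.isCompact.isClosed

lemma disjoint (h : IsMultistepGap σP σQ 0 n δ) : Disjoint (σP n) (σQ n) := by
  obtain ⟨A, B, -, -, hAB, hPA, hQB, -⟩ := h
  exact hAB.mono (fun _ hz => hPA (Set.mem_biUnion (Set.mem_Iic.mpr le_rfl) hz))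
    fun _ hz => hQB (Set.mem_biUnion (Set.mem_Iic.mpr le_rfl) hz)

lemma spectralSplit (h : IsMultistepGap σP σQ 0 n δ) {U : H →L[ℂ] H} (hU : IsStarNormal U)
    (hσ : spectrum ℂ U = σP n ∪ σQ n) : SpectralSplit U (σP n) (σQ n) where
  normal := hU
  spectrum_eq := hσ
  isClosed_left := h.isClosed_left (hσ ▸ spectrum.isClosed U)
  isClosed_right := h.symm.isClosed_left (by rw [Set.union_comm, ← hσ]; exact spectrum.isClosed U)
  disjoint := h.disjoint

lemma sylvesterWellPosed (h : IsMultistepGap σP σQ k n δ) (hi : i ≤ k) (hj : j ≤ k)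
    (si : SpectralSplit (W (n + i)) (σP (n + i)) (σQ (n + i)))
    (sj : SpectralSplit (W (n + j)) (σP (n + j)) (σQ (n + j))) :
    SylvesterWellPosed (W (n + i)) (specProj (W (n + i)) (σP (n + i)))
      (W (n + j)) (specProj (W (n + j)) (σQ (n + j))) (gapConst δ) := by
  obtain ⟨A, B, hA, hB, hAB, hPA, hQB, rfl⟩ := h
  exact si.sylvesterWellPosed_of_isArc sj.symm hA hB hAB
    (fun _ hz => hPA (Set.mem_biUnion (Set.mem_Iic.mpr hi) hz))
    fun _ hz => hQB (Set.mem_biUnion (Set.mem_Iic.mpr hj) hz)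

lemma gapBound (h : IsMultistepGap σP σQ k n δ) (hi : i ≤ k) (hj : j ≤ k)
    (si : SpectralSplit (W (n + i)) (σP (n + i)) (σQ (n + i)))
    (sj : SpectralSplit (W (n + j)) (σP (n + j)) (σQ (n + j))) :
    GapBound (W (n + i)) (specProj (W (n + i)) (σP (n + i)))
      (W (n + j)) (specProj (W (n + j)) (σP (n + j))) (gapConst δ) where
  isStarProjection_left := si.isStarProjection
  isStarProjection_right := sj.isStarProjection
  commute_left := si.commute
  commute_right := sj.commute
  nonneg := (gapConst_pos h.pos h.le_pi).le
  wellPosed := sj.one_sub ▸ h.sylvesterWellPosed hi hj si sj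
  wellPosed_compl := by
    have hsymm := h.symm.sylvesterWellPosed hi hj si.symm sj.symm
    rwa [← si.one_sub] at hsymm

end IsMultistepGap

/-! ### Walks with multistep gaps -/

section Scalars

variable {T : ℕ} {c Δ : ℕ → ℕ → ℝ} {m : ℕ} {z : ℝ}

/-- The bound `2 c₁ / (T Δ₁)` for the distance between the spectral projections at the times `m / T`
and `(m + 1) / T`. -/
def shiftBound (T : ℕ) (c Δ : ℕ → ℕ → ℝ) (m : ℕ) : ℝ := 2 * c 1 m / (T * Δ 1 m)

lemma sum_Icc_one_eq_sum_range (N : ℕ) (f : ℕ → ℝ) :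
    ∑ m ∈ Finset.Icc 1 N, f m = ∑ m ∈ Finset.range N, f (m + 1) := by
  rw [Finset.range_eq_Ico, Finset.sum_Ico_add' f 0 N 1, zero_add, Finset.Ico_add_one_right_eq_Icc]

lemma D₃_nonneg (hz0 : 0 ≤ z) (hz1 : z < 1) : 0 ≤ D₃ z := by
  have hD₁ := one_le_D₁ hz0 hz1
  rw [D₃_eq hz0 hz1]
  positivity

lemma G₁_nonneg (hc : 0 ≤ c 1 m) (hc' : 0 ≤ c 1 (m + 1)) (hc₂ : 0 ≤ c 2 m) (h0 : 0 < Δ 2 m)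
    (hpi : Δ 2 m ≤ Real.pi) : 0 ≤ G₁ c Δ m := by
  have hcos := one_sub_cos_half_pos h0 hpi
  rw [G₁]
  positivity

lemma mul_G₁_le_G₃ (hG : 0 ≤ G₁ c Δ m) (hz : 0 ≤ shiftBound T c Δ m)
    (hz1 : shiftBound T c Δ m < 1) (hz1' : shiftBound T c Δ (m + 1) < 1) :
    (D₃ (max (shiftBound T c Δ (m + 1)) (shiftBound T c Δ m)) + D₁ (shiftBound T c Δ m))
      * G₁ c Δ m ≤ G₃ T c Δ m := by
  have hD₃ := D₃_nonneg (hz.trans (le_max_right (shiftBound T c Δ (m + 1)) _)) (max_lt hz1' hz1)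
  have hD₁ := one_le_D₁ hz hz1
  have hG₂ : 0 ≤ G₁ c Δ m * D₃ (max (shiftBound T c Δ (m + 1)) (shiftBound T c Δ m))
    * shiftBound T c Δ m := by positivity
  have hgap : 0 ≤ D₁ (shiftBound T c Δ m) * (8 * c 1 m ^ 2 / Δ 1 m ^ 2) := by positivity
  simp only [shiftBound] at *
  rw [G₃, G₂]
  linarith

lemma sum_shiftBound_sq_le (T : ℕ) (c Δ : ℕ → ℕ → ℝ) (N : ℕ) :
    ∑ m ∈ Finset.range N, shiftBound T c Δ m ^ 2
      ≤ ∑ m ∈ Finset.range (N + 1), 24 * c 1 m ^ 2 / ((T : ℝ) ^ 2 * Δ 1 m ^ 2) := by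
  calc _ ≤ ∑ m ∈ Finset.range N, 24 * c 1 m ^ 2 / ((T : ℝ) ^ 2 * Δ 1 m ^ 2) := by
        refine Finset.sum_le_sum fun m _ => ?_
        rw [shiftBound, div_pow, mul_pow, mul_pow]
        gcongr
        norm_num
    _ ≤ _ := Finset.sum_le_sum_of_subset_of_nonneg (Finset.range_mono N.le_succ)
        fun _ _ _ => by positivity

end Scalars

variable {H : Type*} [NormedAddCommGroup H] [InnerProductSpace ℂ H] [CompleteSpace H]

/-- The spectral projection `P_T(m / T)` of the walk. -/
def walkProj (W : ℕ → H →L[ℂ] H) (σP : ℕ → Set ℂ) (m : ℕ) : H →L[ℂ] H :=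
  specProj (W m) (σP m)

/-- The assumptions of the adiabatic theorem up to the time `n / T`: `W` is a walk with spectrum
`σP ∪ σQ`, multistep differences bounded by `c`, multistep gaps `Δ`, and `T` is so large that
consecutive spectral projections are at distance less than one. -/
structure GappedWalk (T : ℕ) (W : ℕ → H →L[ℂ] H) (σP σQ : ℕ → Set ℂ) (c Δ : ℕ → ℕ → ℝ) (n : ℕ) :
    Prop where
  pos_steps : 0 < T
  mem_unitary : ∀ m ≤ n, W m ∈ unitary (H →L[ℂ] H)
  spectrum_eq : ∀ m ≤ n, spectrum ℂ (W m) = σP m ∪ σQ m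
  norm_fwdDiff_le : ∀ k ∈ Set.Icc 1 2, ∀ m, m + k ≤ n →
    ‖(fwdDiff 1)^[k] W m‖ ≤ c k m / (T : ℝ) ^ k
  isMultistepGap : ∀ k ≤ 2, ∀ m, m + k ≤ n → IsMultistepGap σP σQ k m (Δ k m)
  ratio_lt : ∀ m < n, 2 * c 1 m / Δ 1 m < T

namespace GappedWalk

variable {T : ℕ} {W : ℕ → H →L[ℂ] H} {σP σQ : ℕ → Set ℂ} {c Δ : ℕ → ℕ → ℝ} {n k m i j : ℕ}
  (h : GappedWalk T W σP σQ c Δ n)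

include h

lemma cast_pos_steps : (0 : ℝ) < T := Nat.cast_pos.mpr h.pos_steps

lemma norm_walk_le_one (hm : m ≤ n) : ‖W m‖ ≤ 1 := by
  rw [← mul_one (W m), CStarRing.norm_mem_unitary_mul 1 (h.mem_unitary m hm)]
  exact ContinuousLinearMap.norm_id_le

lemma gap_pos (hk : k ≤ 2) (hm : m + k ≤ n) : 0 < Δ k m := (h.isMultistepGap k hk m hm).pos

lemma gap_le_pi (hk : k ≤ 2) (hm : m + k ≤ n) : Δ k m ≤ Real.pi :=
  (h.isMultistepGap k hk m hm).le_pi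

lemma gapConst_nonneg (hk : k ≤ 2) (hm : m + k ≤ n) : 0 ≤ gapConst (Δ k m) :=
  (gapConst_pos (h.gap_pos hk hm) (h.gap_le_pi hk hm)).le

lemma norm_sub_le (hm : m < n) : ‖W (m + 1) - W m‖ ≤ c 1 m / T := by
  simpa [fwdDiff] using h.norm_fwdDiff_le 1 (by simp) m hm

lemma norm_secondDiff_le (hm : m + 2 ≤ n) :
    ‖W (m + 2) - W (m + 1) - (W (m + 1) - W m)‖ ≤ c 2 m / (T : ℝ) ^ 2 := by
  simpa [fwdDiff] using h.norm_fwdDiff_le 2 (by simp) m hm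

lemma norm_sub_add_two_le (hm : m + 2 ≤ n) :
    ‖W (m + 2) - W m‖ ≤ (c 1 m + c 1 (m + 1)) / T := by
  rw [← sub_add_sub_cancel _ (W (m + 1)), add_comm (c 1 m), add_div]
  exact norm_add_le_of_le (h.norm_sub_le hm) (h.norm_sub_le (by lia))

lemma diff_nonneg (hk : k ∈ Set.Icc 1 2) (hm : m + k ≤ n) : 0 ≤ c k m := by
  simpa [le_div_iff₀ (pow_pos h.cast_pos_steps k)] using
    (norm_nonneg _).trans (h.norm_fwdDiff_le k hk m hm)

lemma diff_one_nonneg (hm : m < n) : 0 ≤ c 1 m := h.diff_nonneg (by simp) hm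

lemma diff_two_nonneg (hm : m + 2 ≤ n) : 0 ≤ c 2 m := h.diff_nonneg (by simp) hm

lemma shiftBound_nonneg (hm : m < n) : 0 ≤ shiftBound T c Δ m := by
  have hc := h.diff_one_nonneg hm
  have hΔ := h.gap_pos one_le_two hm
  rw [shiftBound]
  positivity

lemma shiftBound_lt_one (hm : m < n) : shiftBound T c Δ m < 1 := by
  have hΔ := h.gap_pos one_le_two hm
  rw [shiftBound, div_lt_one (mul_pos h.cast_pos_steps hΔ), ← div_lt_iff₀ hΔ]
  exact h.ratio_lt m hm

lemma shiftBound_le_D₂ (hm : m < n) : shiftBound T c Δ m ≤ D₂ (shiftBound T c Δ m) :=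
  le_D₂ (h.shiftBound_nonneg hm) (h.shiftBound_lt_one hm)

lemma D₂_nonneg (hm : m < n) : 0 ≤ D₂ (shiftBound T c Δ m) :=
  (h.shiftBound_nonneg hm).trans (h.shiftBound_le_D₂ hm)

lemma G₁_nonneg (hm : m + 2 ≤ n) : 0 ≤ G₁ c Δ m :=
  DiscreteAdiabatic.G₁_nonneg (h.diff_one_nonneg (by lia)) (h.diff_one_nonneg hm)
    (h.diff_two_nonneg hm) (h.gap_pos le_rfl hm) (h.gap_le_pi le_rfl hm)

lemma D₃_add_D₁_nonneg (hm : m + 2 ≤ n) :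
    0 ≤ D₃ (max (shiftBound T c Δ (m + 1)) (shiftBound T c Δ m)) + D₁ (shiftBound T c Δ m) := by
  have hz := h.shiftBound_nonneg (m := m) (by lia)
  have hz1 := h.shiftBound_lt_one (m := m) (by lia)
  exact add_nonneg (D₃_nonneg (le_max_of_le_right hz) (max_lt (h.shiftBound_lt_one hm) hz1))
    (zero_le_one.trans (one_le_D₁ hz hz1))

lemma mul_G₁_le_G₃ (hm : m + 2 ≤ n) :
    (D₃ (max (shiftBound T c Δ (m + 1)) (shiftBound T c Δ m)) + D₁ (shiftBound T c Δ m))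
      * G₁ c Δ m ≤ G₃ T c Δ m :=
  DiscreteAdiabatic.mul_G₁_le_G₃ (h.G₁_nonneg hm) (h.shiftBound_nonneg (by lia))
    (h.shiftBound_lt_one (by lia)) (h.shiftBound_lt_one hm)

lemma G₄_nonneg (hm : m + 2 ≤ n) : 0 ≤ G₄ T c Δ m :=
  add_nonneg (div_nonneg ((mul_nonneg (h.D₃_add_D₁_nonneg hm) (h.G₁_nonneg hm)).trans
    (h.mul_G₁_le_G₃ hm)) T.cast_nonneg) (h.diff_one_nonneg (by lia))

lemma spectralSplit (hm : m ≤ n) : SpectralSplit (W m) (σP m) (σQ m) :=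
  (h.isMultistepGap 0 zero_le_two m hm).spectralSplit
    (isStarNormal_of_mem_unitary (h.mem_unitary m hm)) (h.spectrum_eq m hm)

lemma isStarProjection (hm : m ≤ n) : IsStarProjection (walkProj W σP m) :=
  (h.spectralSplit hm).isStarProjection

lemma gapBound (hk : k ≤ 2) (hm : m + k ≤ n) (hi : i ≤ k) (hj : j ≤ k) :
    GapBound (W (m + i)) (walkProj W σP (m + i)) (W (m + j)) (walkProj W σP (m + j))
      (gapConst (Δ k m)) :=
  (h.isMultistepGap k hk m hm).gapBound hi hj (h.spectralSplit (by lia)) (h.spectralSplit (by lia))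

lemma closeProjections (hm : m < n) :
    CloseProjections (walkProj W σP (m + 1)) (walkProj W σP m) (shiftBound T c Δ m) where
  right := h.isStarProjection hm.le
  left := h.isStarProjection hm
  lt_one := h.shiftBound_lt_one hm
  norm_sub_le := by
    have hΔ := h.gap_pos one_le_two hm
    have hgap : ‖walkProj W σP (m + 1) - walkProj W σP m‖ ≤ gapConst (Δ 1 m) * ‖W m - W (m + 1)‖ :=
      (h.gapBound one_le_two hm le_rfl zero_le_one).norm_sub_le
    calc _ ≤ 2 / Δ 1 m * (c 1 m / T) := by
          refine hgap.trans (mul_le_mul (gapConst_le_two_div hΔ (h.gap_le_pi one_le_two hm)) ?_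
            (norm_nonneg _) (by positivity))
          rw [norm_sub_rev]
          exact h.norm_sub_le hm
      _ = shiftBound T c Δ m := by
          rw [shiftBound, div_mul_div_comm, mul_comm (Δ 1 m)]

lemma norm_walkProj_secondDiff_le (hm : m + 2 ≤ n) :
    ‖walkProj W σP (m + 2) - walkProj W σP (m + 1) - (walkProj W σP (m + 1) - walkProj W σP m)‖
      ≤ 8 / Real.pi * G₁ c Δ m / (T : ℝ) ^ 2 := by
  have hT := h.cast_pos_steps
  have hκ := h.gapConst_nonneg le_rfl hm
  have hc := h.diff_one_nonneg (m := m) (by lia)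
  have hc' := h.diff_one_nonneg (m := m + 1) hm
  have hW := h.norm_sub_le (m := m) (by lia)
  have hW₂ := h.norm_sub_add_two_le hm
  have hP : ‖walkProj W σP (m + 1) - walkProj W σP m‖ ≤ gapConst (Δ 2 m) * (c 1 m / T) := by
    refine (h.gapBound le_rfl hm one_le_two zero_le_two).norm_sub_le.trans ?_
    rw [norm_sub_rev]
    gcongr
    exact hW
  have hP₂ : ‖walkProj W σP (m + 2) - walkProj W σP m‖
      ≤ gapConst (Δ 2 m) * ((c 1 m + c 1 (m + 1)) / T) := by
    refine (h.gapBound le_rfl hm le_rfl zero_le_two).norm_sub_le.trans ?_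
    rw [norm_sub_rev]
    gcongr
    exact hW₂
  calc _ ≤ gapConst (Δ 2 m) * ((c 1 m + c 1 (m + 1)) / T) * (gapConst (Δ 2 m) * (c 1 m / T))
          + gapConst (Δ 2 m) * (c 2 m / (T : ℝ) ^ 2
            + gapConst (Δ 2 m) * ((c 1 m + c 1 (m + 1)) / T) * (c 1 m / T)
            + (c 1 m + c 1 (m + 1)) / T * (gapConst (Δ 2 m) * (c 1 m / T))) := by
        refine ((h.gapBound le_rfl hm le_rfl one_le_two).norm_secondDiff_le
          (h.isStarProjection (by lia)) (h.spectralSplit (by lia)).commute).trans ?_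
        gcongr
        exact h.norm_secondDiff_le hm
    _ = (gapConst (Δ 2 m) * c 2 m
          + 3 * gapConst (Δ 2 m) ^ 2 * (c 1 m ^ 2 + c 1 m * c 1 (m + 1))) / (T : ℝ) ^ 2 := by
        field_simp
        ring
    _ ≤ _ := by
        gcongr
        exact gapConst_secondDiff_le (h.gap_pos le_rfl hm) (h.gap_le_pi le_rfl hm) hc hc'
          (h.diff_two_nonneg hm)

end GappedWalk

/-! ### The adiabatic error -/

/-- The off-diagonal part `Y` of `star V = v + Y` for the spectral projections of the walk at the
times `m / T` and `(m + 1) / T`. -/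
def walkY (W : ℕ → H →L[ℂ] H) (σP : ℕ → Set ℂ) (m : ℕ) : H →L[ℂ] H :=
  opY (walkProj W σP (m + 1)) (walkProj W σP m)

/-- `X` solves the off-diagonal commutator equation with right-hand side `walkY W σP m`. The
equation lives at the time `(m + 1) / T`. -/
abbrev WalkSolution (W : ℕ → H →L[ℂ] H) (σP : ℕ → Set ℂ) (m : ℕ) (X : H →L[ℂ] H) : Prop :=
  OffDiagSolution (walkProj W σP (m + 1)) (W (m + 1)) (walkY W σP m) X

namespace GappedWalk

variable {T : ℕ} {W : ℕ → H →L[ℂ] H} {σP σQ : ℕ → Set ℂ} {c Δ : ℕ → ℕ → ℝ} {n m N : ℕ}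
  {X X' : H →L[ℂ] H} (h : GappedWalk T W σP σQ c Δ n)

include h

lemma exists_walkSolution : ∃ X : ℕ → H →L[ℂ] H, ∀ m < n, WalkSolution W σP m (X m) := by
  refine ⟨fun m => Classical.epsilon (WalkSolution W σP m), fun m hm => Classical.epsilon_spec ?_⟩
  exact (h.gapBound (m := m + 1) zero_le_two hm le_rfl le_rfl).exists_offDiagSolution
    (mul_opY_right (h.isStarProjection hm.le) (h.isStarProjection hm))

lemma norm_walkY_le (hm : m < n) : ‖walkY W σP m‖ ≤ D₂ (shiftBound T c Δ m) :=
  ((h.closeProjections hm).norm_opY.trans_le (h.closeProjections hm).norm_sub_le).trans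
    (h.shiftBound_le_D₂ hm)

lemma norm_one_sub_opv_le (hm : m < n) :
    ‖1 - opv (walkProj W σP (m + 1)) (walkProj W σP m)‖ ≤ shiftBound T c Δ m ^ 2 := by
  have hpos := one_sub_sq_pos (h.shiftBound_nonneg hm) (h.shiftBound_lt_one hm)
  have hsqrt : 1 - shiftBound T c Δ m ^ 2 ≤ √(1 - shiftBound T c Δ m ^ 2) :=
    Real.le_sqrt_of_sq_le (by nlinarith [sq_nonneg (shiftBound T c Δ m)])
  linarith [(h.closeProjections hm).norm_one_sub_opv_le]

lemma gapConst_mul_norm_walkY_succ_sub_le (hm : m + 2 ≤ n) :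
    gapConst (Δ 1 (m + 1)) * ‖walkY W σP (m + 1) - walkY W σP m‖
      ≤ 4 * G₃ T c Δ m / ((T : ℝ) ^ 2 * Δ 1 (m + 1)) := by
  have hT := h.cast_pos_steps
  have hΔ := h.gap_pos one_le_two hm
  have hD := h.D₃_add_D₁_nonneg hm
  have hnext : CloseProjections (walkProj W σP (m + 2)) (walkProj W σP (m + 1))
      (max (shiftBound T c Δ (m + 1)) (shiftBound T c Δ m)) :=
    { h.closeProjections (m := m + 1) hm with
      norm_sub_le := (h.closeProjections (m := m + 1) hm).norm_sub_le.trans (le_max_left _ _)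
      lt_one := max_lt (h.shiftBound_lt_one hm) (h.shiftBound_lt_one (by lia)) }
  have hY := (h.closeProjections (by lia)).norm_opY_sub_opY_le hnext (le_max_right _ _)
  calc gapConst (Δ 1 (m + 1)) * ‖walkY W σP (m + 1) - walkY W σP m‖
      ≤ Real.pi / (2 * Δ 1 (m + 1))
        * ((D₃ (max (shiftBound T c Δ (m + 1)) (shiftBound T c Δ m)) + D₁ (shiftBound T c Δ m))
          * (8 / Real.pi * G₁ c Δ m / (T : ℝ) ^ 2)) := by
        gcongr
        · exact gapConst_le hΔ (h.gap_le_pi one_le_two hm)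
        · exact hY.trans (by gcongr; exact h.norm_walkProj_secondDiff_le hm)
    _ = 4 * ((D₃ (max (shiftBound T c Δ (m + 1)) (shiftBound T c Δ m))
        + D₁ (shiftBound T c Δ m)) * G₁ c Δ m) / ((T : ℝ) ^ 2 * Δ 1 (m + 1)) := by
        field_simp
        ring
    _ ≤ _ := by
        gcongr
        exact h.mul_G₁_le_G₃ hm

lemma norm_walkSolution_le (hm : m < n) (hX : WalkSolution W σP m X) :
    ‖X‖ ≤ 2 / Δ 0 (m + 1) * D₂ (shiftBound T c Δ m) := by
  have hΔ := h.gap_pos (m := m + 1) zero_le_two hm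
  refine (hX.norm_le (h.gapBound (m := m + 1) zero_le_two hm le_rfl le_rfl)
    (h.norm_walk_le_one hm)).trans ?_
  exact mul_le_mul (gapConst_le_two_div hΔ (h.gap_le_pi zero_le_two hm)) (h.norm_walkY_le hm)
    (norm_nonneg _) (by positivity)

lemma norm_walkSolution_le_gapConst (hm : m + 2 ≤ n) (hX : WalkSolution W σP m X) :
    ‖X‖ ≤ gapConst (Δ 1 (m + 1)) * D₂ (shiftBound T c Δ m) :=
  (hX.norm_le (h.gapBound (m := m + 1) one_le_two hm zero_le_one zero_le_one)
    (h.norm_walk_le_one (m := m + 1) (by lia))).trans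
    (mul_le_mul_of_nonneg_left (h.norm_walkY_le (by lia)) (h.gapConst_nonneg one_le_two hm))

lemma gapConst_mul_norm_sub_mul_le (hm : m + 2 ≤ n) (hX : WalkSolution W σP m X) :
    gapConst (Δ 1 (m + 1)) * (‖W (m + 2) - W (m + 1)‖ * (‖walkY W σP m‖ + 2 * ‖X‖))
      ≤ 4 * c 1 (m + 1) / (Real.pi * T * (1 - Real.cos (Δ 1 (m + 1) / 2)))
        * D₂ (shiftBound T c Δ m) := by
  have hT := h.cast_pos_steps
  have hκ := h.gapConst_nonneg one_le_two hm
  have hc := h.diff_one_nonneg (m := m + 1) hm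
  have hD := h.D₂_nonneg (m := m) (by lia)
  have hY := h.norm_walkY_le (m := m) (by lia)
  calc _ ≤ gapConst (Δ 1 (m + 1)) * (c 1 (m + 1) / T * (D₂ (shiftBound T c Δ m)
          + 2 * (gapConst (Δ 1 (m + 1)) * D₂ (shiftBound T c Δ m)))) := by
        gcongr
        · exact h.norm_sub_le hm
        · exact h.norm_walkSolution_le_gapConst hm hX
    _ = c 1 (m + 1) / T * (gapConst (Δ 1 (m + 1)) + 2 * gapConst (Δ 1 (m + 1)) ^ 2)
        * D₂ (shiftBound T c Δ m) := by ring
    _ ≤ c 1 (m + 1) / T * (4 / (Real.pi * (1 - Real.cos (Δ 1 (m + 1) / 2))))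
        * D₂ (shiftBound T c Δ m) := by
        gcongr
        exact gapConst_add_sq_le (h.gap_pos one_le_two hm) (h.gap_le_pi one_le_two hm)
    _ = _ := by
        rw [div_mul_div_comm, mul_comm (c 1 (m + 1)), mul_left_comm, mul_assoc Real.pi]

lemma norm_walkSolution_succ_sub_le (hm : m + 2 ≤ n) (hX : WalkSolution W σP m X)
    (hX' : WalkSolution W σP (m + 1) X') :
    ‖X' - X‖ ≤ 2 * D₂ (shiftBound T c Δ (m + 1)) * (2 / Δ 0 (m + 1) * D₂ (shiftBound T c Δ m))
      + (4 * G₃ T c Δ m / ((T : ℝ) ^ 2 * Δ 1 (m + 1))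
        + 4 * c 1 (m + 1) / (Real.pi * T * (1 - Real.cos (Δ 1 (m + 1) / 2)))
          * D₂ (shiftBound T c Δ m)) := by
  have hD := h.D₂_nonneg (m := m + 1) hm
  have hP : ‖walkProj W σP (m + 2) - walkProj W σP (m + 1)‖ ≤ D₂ (shiftBound T c Δ (m + 1)) :=
    (h.closeProjections hm).norm_sub_le.trans (h.shiftBound_le_D₂ hm)
  refine (hX.norm_sub_le hX' (h.isStarProjection (by lia))
    (h.gapBound (m := m + 1) one_le_two hm le_rfl le_rfl)
    (h.norm_walk_le_one hm)).trans (add_le_add ?_ ?_)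
  · gcongr
    exact h.norm_walkSolution_le (by lia) hX
  · rw [mul_add]
    exact add_le_add (h.gapConst_mul_norm_walkY_succ_sub_le hm)
      (h.gapConst_mul_norm_sub_mul_le hm hX)


lemma summand_le (hm : m + 2 ≤ n) (hX : WalkSolution W σP m X)
    (hX' : WalkSolution W σP (m + 1) X') :
    ‖1 - opv (walkProj W σP (m + 1)) (walkProj W σP m)‖
      + ‖X'‖ * ‖opV (walkProj W σP (m + 1)) (walkProj W σP m) - 1‖
      + 2 * ‖opV (walkProj W σP (m + 2)) (walkProj W σP (m + 1)) - 1‖ * ‖X‖ + ‖X' - X‖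
    ≤ 4 * (1 / Δ 0 (m + 2) + 2 / Δ 0 (m + 1)) * D₂ (shiftBound T c Δ (m + 1))
        * D₂ (shiftBound T c Δ m)
      + 4 * G₃ T c Δ m / ((T : ℝ) ^ 2 * Δ 1 (m + 1))
      + 4 * c 1 (m + 1) / (Real.pi * T * (1 - Real.cos (Δ 1 (m + 1) / 2)))
        * D₂ (shiftBound T c Δ m)
      + shiftBound T c Δ m ^ 2 := by
  have hm₁ : m < n := by lia
  have hΔ := h.gap_pos (m := m + 2) zero_le_two hm
  have hD := h.D₂_nonneg hm₁
  have hD' := h.D₂_nonneg (m := m + 1) hm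
  have hX'V : ‖X'‖ * ‖opV (walkProj W σP (m + 1)) (walkProj W σP m) - 1‖
      ≤ 2 / Δ 0 (m + 2) * D₂ (shiftBound T c Δ (m + 1)) * D₂ (shiftBound T c Δ m) :=
    mul_le_mul (h.norm_walkSolution_le hm hX') (h.closeProjections hm₁).norm_opV_sub_one_le
      (norm_nonneg _) (by positivity)
  have hVX : 2 * ‖opV (walkProj W σP (m + 2)) (walkProj W σP (m + 1)) - 1‖ * ‖X‖
      ≤ 2 * D₂ (shiftBound T c Δ (m + 1)) * (2 / Δ 0 (m + 1) * D₂ (shiftBound T c Δ m)) := by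
    gcongr
    · exact (h.closeProjections hm).norm_opV_sub_one_le
    · exact h.norm_walkSolution_le hm₁ hX
  have hspare : 0 ≤ 2 / Δ 0 (m + 2) * D₂ (shiftBound T c Δ (m + 1)) * D₂ (shiftBound T c Δ m) := by
    positivity
  linear_combination h.norm_one_sub_opv_le hm₁ + hX'V + hVX + hspare
    + h.norm_walkSolution_succ_sub_le hm hX hX'

lemma boundary_nonneg (hm : m < n) : 0 ≤ 2 / Δ 0 (m + 1) * D₂ (shiftBound T c Δ m) :=
  mul_nonneg (div_nonneg zero_le_two (h.gap_pos (m := m + 1) zero_le_two hm).le) (h.D₂_nonneg hm)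

lemma sum_G₄_nonneg (hN : N < n) :
    0 ≤ ∑ m ∈ Finset.range N, 4 * G₄ T c Δ m / (T * Δ 0 (m + 1)) * D₂ (shiftBound T c Δ m) := by
  refine Finset.sum_nonneg fun m hm => ?_
  have hm := Finset.mem_range.mp hm
  have hΔ := h.gap_pos (m := m + 1) zero_le_two (by lia)
  have hG₄ := h.G₄_nonneg (m := m) (by lia)
  have hD := h.D₂_nonneg (m := m) (by lia)
  positivity

lemma sum_inv_one_sub_nonneg :
    0 ≤ ∑ m ∈ Finset.range n, 4 * c 1 m ^ 2 / ((T : ℝ) ^ 2 * Δ 1 m ^ 2)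
      * (1 - shiftBound T c Δ m)⁻¹ := by
  refine Finset.sum_nonneg fun m hm => mul_nonneg (by positivity) (inv_nonneg.mpr ?_)
  exact sub_nonneg.mpr (h.shiftBound_lt_one (Finset.mem_range.mp hm)).le

omit h in
lemma norm_evolution_sub_adiabaticEvolution_le (h : GappedWalk T W σP σQ c Δ (N + 1)) :
    ‖evolution W (N + 1) - adiabaticEvolution W σP (N + 1)‖ ≤
      D₂ (shiftBound T c Δ N) + 2 / Δ 0 (N + 1) * D₂ (shiftBound T c Δ N)
      + 2 / Δ 0 1 * D₂ (shiftBound T c Δ 0)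
      + ∑ m ∈ Finset.range N, (4 * (1 / Δ 0 (m + 2) + 2 / Δ 0 (m + 1))
          * D₂ (shiftBound T c Δ (m + 1)) * D₂ (shiftBound T c Δ m)
        + 4 * G₃ T c Δ m / ((T : ℝ) ^ 2 * Δ 1 (m + 1))
        + 4 * c 1 (m + 1) / (Real.pi * T * (1 - Real.cos (Δ 1 (m + 1) / 2)))
          * D₂ (shiftBound T c Δ m)
        + shiftBound T c Δ m ^ 2) := by
  obtain ⟨X, hX⟩ := h.exists_walkSolution
  have hclose : ∀ m ≤ N, CloseProjections (walkProj W σP (m + 1)) (walkProj W σP m)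
      (shiftBound T c Δ m) := fun m hm => h.closeProjections (Nat.lt_succ_of_le hm)
  have hsplit := norm_evolution_sub_evolution_le (N := N)
    (V := fun m => opV (walkProj W σP (m + 1)) (walkProj W σP m))
    (fun m hm => h.mem_unitary m (by lia)) (fun m hm => (hclose m hm).opV_mem_unitary)
    (fun m hm => (hclose m hm.le).star_opV) (fun m hm => (hX m (by lia)).commutator_eq)
  refine hsplit.trans (add_le_add (add_le_add_three (hclose N le_rfl).norm_opV_sub_one_le
    (h.norm_walkSolution_le N.lt_succ_self (hX N N.lt_succ_self))
    (h.norm_walkSolution_le N.succ_pos (hX 0 N.succ_pos))) (Finset.sum_le_sum fun m hm => ?_))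
  have hm := Finset.mem_range.mp hm
  exact h.summand_le (by lia) (hX m (by lia)) (hX (m + 1) (by lia))

end GappedWalk

end DiscreteAdiabatic

end

open DiscreteAdiabatic in
theorem theorem15 {H : Type*} [NormedAddCommGroup H] [InnerProductSpace ℂ H] [CompleteSpace H]
    (T : ℕ)
    -- the walk operators `W m = W_T(m/T)`, `0 ≤ m ≤ T`
    (W : ℕ → H →L[ℂ] H) (hW : ∀ m ≤ T, W m ∈ unitary (H →L[ℂ] H))
    -- the spectrum of interest and the complementary spectrum
    (σP σQ : ℕ → Set ℂ) (hσ : ∀ m ≤ T, spectrum ℂ (W m) = σP m ∪ σQ m)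
    -- the multistep differences, `c k m = c_k(m/T)`
    (c : ℕ → ℕ → ℝ)
    (hc : ∀ k ∈ Set.Icc 1 2, ∀ m, m + k ≤ T → ‖(fwdDiff 1)^[k] W m‖ ≤ c k m / (T : ℝ) ^ k)
    -- the multistep gaps, `Δ k m = Δ_k(m/T)`
    (Δ : ℕ → ℕ → ℝ)
    (hΔ : ∀ k ≤ 2, ∀ m, m + k ≤ T → IsMultistepGap σP σQ k m (Δ k m))
    (hT : ∀ m < T, 2 * c 1 m / Δ 1 m ≤ T)
    -- the time `s = n/T`; no denominator of the bound vanishes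
    (n : ℕ) (hn : 1 ≤ n) (hnT : n ≤ T) (hne : ∀ m < n, 2 * c 1 m / Δ 1 m ≠ T) :
    ‖evolution W n - adiabaticEvolution W σP n‖ ≤
      4 / Δ 0 1 * D₂ (2 * c 1 0 / (T * Δ 1 0))
      + 4 / Δ 0 n * D₂ (2 * c 1 (n - 1) / (T * Δ 1 (n - 1)))
      + 2 * D₂ (2 * c 1 (n - 1) / (T * Δ 1 (n - 1)))
      + ∑ m ∈ Finset.Icc 1 (n - 1), 4 * (1 / Δ 0 (m + 1) + 2 / Δ 0 m)
          * D₂ (2 * c 1 m / (T * Δ 1 m)) * D₂ (2 * c 1 (m - 1) / (T * Δ 1 (m - 1)))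
      + ∑ m ∈ Finset.Icc 1 (n - 1), 4 * G₃ T c Δ (m - 1) / (T ^ 2 * Δ 1 m)
      + ∑ m ∈ Finset.Icc 1 (n - 1), 4 * c 1 m / (Real.pi * T * (1 - Real.cos (Δ 1 m / 2)))
          * D₂ (2 * c 1 (m - 1) / (T * Δ 1 (m - 1)))
      + ∑ m ∈ Finset.Icc 1 (n - 1), 4 * G₄ T c Δ (m - 1) / (T * Δ 0 m)
          * D₂ (2 * c 1 (m - 1) / (T * Δ 1 (m - 1)))
      + ∑ m ∈ Finset.range n, 24 * c 1 m ^ 2 / (T ^ 2 * Δ 1 m ^ 2)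
      + ∑ m ∈ Finset.range n, 4 * c 1 m ^ 2 / (T ^ 2 * Δ 1 m ^ 2)
          * (1 - 2 * c 1 m / (T * Δ 1 m))⁻¹ := by
  obtain ⟨N, rfl⟩ : ∃ N, n = N + 1 := ⟨n - 1, (Nat.sub_add_cancel hn).symm⟩
  have hwalk : GappedWalk T W σP σQ c Δ (N + 1) :=
    { pos_steps := hn.trans hnT
      mem_unitary := fun m hm => hW m (hm.trans hnT)
      spectrum_eq := fun m hm => hσ m (hm.trans hnT)
      norm_fwdDiff_le := fun k hk m hm => hc k hk m (hm.trans hnT)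
      isMultistepGap := fun k hk m hm => hΔ k hk m (hm.trans hnT)
      ratio_lt := fun m hm => (hT m (hm.trans_le hnT)).lt_of_ne (hne m hm) }
  have herror := hwalk.norm_evolution_sub_adiabaticEvolution_le
  have hfirst := hwalk.boundary_nonneg N.succ_pos
  have hlast := hwalk.boundary_nonneg N.lt_succ_self
  have hlast' := hwalk.D₂_nonneg N.lt_succ_self
  have hG₄ := hwalk.sum_G₄_nonneg N.lt_succ_self
  have hquad := sum_shiftBound_sq_le T c Δ N
  have hinv := hwalk.sum_inv_one_sub_nonneg
  simp only [sum_Icc_one_eq_sum_range, Nat.add_sub_cancel]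
  simp only [Finset.sum_add_distrib, shiftBound, zero_add] at *
  linear_combination herror + hfirst + hlast + hlast' + hG₄ + hquad + hinv
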